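/- Let $k\ge 2$ be an integer, let $q\in\mathbb C^\times$ satisfy $q^{2j}\ne 1$ for $1\le j\le k$, and put $\beta=q+q^{-1}$ and $[m]=(q^m-q^{-m})/(q-q^{-1})$. An $(m,d)$-diagram consists of non-crossing links, drawn in a rectangle up to isotopy, that join pairwise $m$ points on its left side and $d$ points on its right side; it is monic if it has $d$ links from left to right (its $d$ right ends are then called defects). Diagrams are composed, bilinearly, by concatenation, each closed loop being replaced by a factor $\beta$; the linear combinations of $(N,N)$-diagrams form the Temperley–Lieb algebra $\mathsf{TL}_N(\beta)$, with generators $E_1,\dots,E_{N-1}$, where $E_i$ joins the points $i$ and $i+1$ on each side (counted from the top) and every other point to the point at the same height on the other side. Write $x\mapsto x^*$ for the linear extension of the left-right reflection of diagrams. The Wenzl–Jones projectors in $\mathsf{TL}_N(\beta)$ are $P_1=\mathrm{Id}$, $P_j=P_{j-1}-\frac{[j-1]}{[j]}P_{j-1}E_{N-j+1}P_{j-1}$ (so $P_j$ acts on the $j$ bottom points). For integers $n,d\ge0$, let $\mathfrak B_{n,k}^d$ be the set of vectors $P_kw$, where $w$ runs over the monic $(n+k,d)$-diagrams that have no link between two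 of the $k$ bottom left points and $P_k\in \mathsf{TL}_{n+k}(\beta)$. Let $\mathcal G_{n,k}^d$ be the matrix, with rows and columns indexed by $\mathfrak B_{n,k}^d$, whose entry at $(P_kv,P_kw)$ is the coefficient of the identity $(d,d)$-diagram in $(P_kv)^*(P_kw)$. (The sets may be empty.) Let now $n\geq 1$ and $d\ge1$, and suppose that $[d+1]\neq 0$. Order $\mathfrak B_{n,k}^d$ by putting first the family $F_1$ of the elements whose top left point is joined to the right side, and then the family $F_2$ of those whose top left point is joined to a lower left point. Adding a through line at the top is a bijection $\mathfrak B_{n-1,k}^{d-1}\to F_1$, and bending the topmost right point into an arc that ends at a new top left point is a bijection $\mathfrak B_{n-1,k}^{d+1}\to F_2$; order $F_1$ and $F_2$ accordingly. Then there is an upper unitriangular matrix $\mathcal U$, of the form $\begin{pmatrix}1&A\\0&1\end{pmatrix}$ with respect to $F_1\sqcup F_2$, such that $$\mathcal U^T\,\mathcal G_{n,k}^d\,\mathcal U=\begin{pmatrix}\mathcal G_{n-1,k}^{d-1}&0\\0&\frac{[d+2]}{[d+1]}\,\mathcal G_{n-1,k}^{d+1}\end{pmatrix}.$$ Moreover,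 $\mathcal U$ can be chosen so that, if in addition $[j]\neq0$ for all $1\le j\le d+1$ (so that the projector $P_{d+1}\in\mathsf{TL}_{d+1}(\beta)$ is defined), the new basis that it describes is the following: the elements of $F_1$ are unchanged, and the element of $F_2$ that corresponds to $P_kw\in\mathfrak B_{n-1,k}^{d+1}$ is replaced by the vector obtained from $P_kwP_{d+1}$ by bending its topmost right point into an arc that ends at a new top left point, where linear combinations of $(n+k,d)$-diagrams are compared modulo the diagrams that are not monic. -/

import Mathlib

namespace TemperleyLieb

/-- Position of a marked point when the boundary of the rectangle is traversed once: down the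
left side, then up the right side.  On both sides the points are numbered from top (`0`) to
bottom. -/
def pos {m d : ℕ} : Fin m ⊕ Fin d → ℕ
  | Sum.inl i => i
  | Sum.inr j => m + (d - 1 - j)

/-- An `(m, d)`-diagram up to isotopy: a perfect matching, without crossings, of `m` points on the
left side and `d` points on the right side of a rectangle.  `mate x` is the other end of the link
starting at `x`. -/
@[ext]
structure Diagram (m d : ℕ) where
  mate : Fin m ⊕ Fin d → Fin m ⊕ Fin d
  mate_mate : ∀ x, mate (mate x) = x
  mate_ne : ∀ x, mate x ≠ x
  noncrossing : ∀ x y, ¬ (pos x < pos y ∧ pos y < pos (mate x) ∧ pos (mate x) < pos (mate y))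

namespace Diagram

noncomputable instance (m d : ℕ) : Fintype (Diagram m d) :=
  Fintype.ofInjective Diagram.mate (fun _ _ h => Diagram.ext h)

noncomputable instance (m d : ℕ) : DecidableEq (Diagram m d) := Classical.decEq _

/-- An `(m, d)`-diagram is monic if it has `d` through lines: every right point is joined to a
left point. -/
def IsMonic {m d : ℕ} (D : Diagram m d) : Prop :=
  ∀ j : Fin d, ∃ i : Fin m, D.mate (Sum.inr j) = Sum.inl i

/-- The identity diagram. -/
def id (n : ℕ) : Diagram n n where
  mate := Sum.swap
  mate_mate := by rintro (x | x) <;> rfl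
  mate_ne := by rintro (x | x) <;> simp
  noncrossing := by
    rintro (x | x) (y | y) <;> simp only [pos, Sum.swap_inl, Sum.swap_inr] <;> omega

/-- The mate function of the diagram `E_i`, where `a = i` and `b = i + 1`. -/
def genMate {n : ℕ} (a b : Fin n) : Fin n ⊕ Fin n → Fin n ⊕ Fin n
  | Sum.inl x => if x = a then Sum.inl b else if x = b then Sum.inl a else Sum.inr x
  | Sum.inr x => if x = a then Sum.inr b else if x = b then Sum.inr a else Sum.inl x

/-- The diagram `E_i`: on each side the points `i` and `i + 1` (counted from `0`) are joined, and
every other left point is joined to the right point at the same height. -/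
def gen {n : ℕ} (i : ℕ) (h : i + 1 < n) : Diagram n n where
  mate := genMate ⟨i, by omega⟩ ⟨i + 1, h⟩
  mate_mate := by
    rintro (x | x) <;> simp only [genMate] <;> split_ifs <;> simp_all
  mate_ne := by
    rintro (x | x) <;> simp only [genMate] <;> split_ifs <;> simp_all [Fin.ext_iff]
  noncrossing := by
    rintro (x | x) (y | y) <;> simp only [genMate] <;> split_ifs <;>
      simp_all only [pos, Fin.ext_iff] <;> omega

theorem pos_swap {m d : ℕ} (x : Fin d ⊕ Fin m) : pos x.swap + pos x + 1 = m + d := by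
  rcases x with x | x <;> simp only [pos, Sum.swap_inl, Sum.swap_inr] <;> omega

/-- The reflection `D ↦ D^*` through a vertical mirror. -/
def reflect {m d : ℕ} (D : Diagram m d) : Diagram d m where
  mate x := (D.mate x.swap).swap
  mate_mate x := by simp [D.mate_mate]
  mate_ne x h := D.mate_ne x.swap (by rw [← Sum.swap_swap (D.mate x.swap), h])
  noncrossing x y := by
    have h := D.noncrossing (D.mate y.swap) (D.mate x.swap)
    rw [D.mate_mate, D.mate_mate] at h
    have h1 := pos_swap x
    have h2 := pos_swap y
    have h3 := pos_swap (D.mate x.swap)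
    have h4 := pos_swap (D.mate y.swap)
    omega

/-- Relabelling of points when a new point is added at the top of both sides. -/
def shift {m d : ℕ} : Fin m ⊕ Fin d → Fin (m + 1) ⊕ Fin (d + 1) := Sum.map Fin.succ Fin.succ

/-- The mate function of `addTop`. -/
def addTopMate {m d : ℕ} (D : Diagram m d) :
    Fin (m + 1) ⊕ Fin (d + 1) → Fin (m + 1) ⊕ Fin (d + 1)
  | Sum.inl x => Fin.cases (Sum.inr 0) (fun i => shift (D.mate (Sum.inl i))) x
  | Sum.inr x => Fin.cases (Sum.inl 0) (fun j => shift (D.mate (Sum.inr j))) x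

@[simp] theorem addTopMate_shift {m d : ℕ} (D : Diagram m d) (x : Fin m ⊕ Fin d) :
    addTopMate D (shift x) = shift (D.mate x) := by
  rcases x with x | x <;> simp [shift, addTopMate]

@[simp] theorem addTopMate_inl_zero {m d : ℕ} (D : Diagram m d) :
    addTopMate D (Sum.inl 0) = Sum.inr 0 := rfl

@[simp] theorem addTopMate_inr_zero {m d : ℕ} (D : Diagram m d) :
    addTopMate D (Sum.inr 0) = Sum.inl 0 := rfl

theorem shift_cases {m d : ℕ} (x : Fin (m + 1) ⊕ Fin (d + 1)) :
    x = Sum.inl 0 ∨ x = Sum.inr 0 ∨ ∃ y : Fin m ⊕ Fin d, x = shift y := by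
  rcases x with x | x
  · refine Fin.cases (Or.inl rfl) (fun i => Or.inr (Or.inr ⟨Sum.inl i, rfl⟩)) x
  · refine Fin.cases (Or.inr (Or.inl rfl)) (fun i => Or.inr (Or.inr ⟨Sum.inr i, rfl⟩)) x

theorem shift_injective {m d : ℕ} : Function.Injective (shift (m := m) (d := d)) :=
  Sum.map_injective.2 ⟨Fin.succ_injective _, Fin.succ_injective _⟩

theorem pos_shift {m d : ℕ} (x : Fin m ⊕ Fin d) : pos (shift x) = pos x + 1 := by
  rcases x with x | x
  · simp [shift, pos]
  · have := x.2
    simp only [shift, pos, Sum.map_inr, Fin.val_succ]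
    omega

theorem pos_inl_zero {m d : ℕ} : pos (Sum.inl 0 : Fin (m + 1) ⊕ Fin d) = 0 := rfl

theorem pos_inr_zero {m d : ℕ} : pos (Sum.inr 0 : Fin m ⊕ Fin (d + 1)) = m + d := by
  simp [pos]

theorem pos_lt {m d : ℕ} (x : Fin m ⊕ Fin d) : pos x < m + d := by
  rcases x with x | x
  · simp only [pos]; omega
  · have := x.2
    simp only [pos]; omega

/-- Add a through line at the top of a diagram. -/
def addTop {m d : ℕ} (D : Diagram m d) : Diagram (m + 1) (d + 1) where
  mate := addTopMate D
  mate_mate x := by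
    rcases shift_cases x with rfl | rfl | ⟨y, rfl⟩ <;> simp [D.mate_mate]
  mate_ne x := by
    rcases shift_cases x with rfl | rfl | ⟨y, rfl⟩
    · simp
    · simp
    · simpa using fun h => D.mate_ne y (shift_injective h)
  noncrossing x y := by
    rcases shift_cases x with rfl | rfl | ⟨x, rfl⟩ <;>
    rcases shift_cases y with rfl | rfl | ⟨y, rfl⟩ <;>
    simp only [addTopMate_shift, addTopMate_inl_zero, addTopMate_inr_zero, pos_shift,
      pos_inl_zero, pos_inr_zero]
    case inr.inr.inr.inr => have := D.noncrossing x y; omega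
    all_goals first
      | omega
      | (have := pos_lt y; have := pos_lt (D.mate y); omega)

/-- Relabelling of points when the topmost right point is moved to the top of the left side. -/
def turn {m d : ℕ} : Fin m ⊕ Fin (d + 1) ≃ Fin (m + 1) ⊕ Fin d where
  toFun
    | Sum.inl i => Sum.inl i.succ
    | Sum.inr j => Fin.cases (Sum.inl 0) Sum.inr j
  invFun
    | Sum.inl i => Fin.cases (Sum.inr 0) Sum.inl i
    | Sum.inr j => Sum.inr j.succ
  left_inv := by
    rintro (x | x)
    · rfl
    · refine Fin.cases rfl (fun _ => rfl) x
  right_inv := by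
    rintro (x | x)
    · refine Fin.cases rfl (fun _ => rfl) x
    · rfl

theorem pos_turn {m d : ℕ} (x : Fin m ⊕ Fin (d + 1)) :
    (pos x < m + d ∧ pos (turn x) = pos x + 1) ∨ (pos x = m + d ∧ pos (turn x) = 0) := by
  rcases x with x | x
  · left
    have hx : turn (Sum.inl x : Fin m ⊕ Fin (d + 1)) = Sum.inl x.succ := rfl
    have hlt := x.2
    rw [hx]
    exact ⟨by simp only [pos]; omega, by simp [pos]⟩
  · refine Fin.cases ?_ (fun j => ?_) x
    · right
      have hx : turn (Sum.inr 0 : Fin m ⊕ Fin (d + 1)) = Sum.inl 0 := rfl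
      rw [hx]
      simp [pos]
    · left
      have hx : turn (Sum.inr j.succ : Fin m ⊕ Fin (d + 1)) = Sum.inr j := rfl
      rw [hx]
      have := j.2
      simp only [pos, Fin.val_succ]
      omega

/-- Close the topmost right point of a diagram into an arc that ends at a new point added at the
top of the left side. -/
def closeTop {m d : ℕ} (D : Diagram m (d + 1)) : Diagram (m + 1) d where
  mate x := turn (D.mate (turn.symm x))
  mate_mate x := by simp [D.mate_mate]
  mate_ne x h := D.mate_ne (turn.symm x) (by rw [Equiv.eq_symm_apply, h])
  noncrossing x y := by
    obtain ⟨x, rfl⟩ := turn.surjective x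
    obtain ⟨y, rfl⟩ := turn.surjective y
    simp only [Equiv.symm_apply_apply]
    have h1 := D.noncrossing x y
    have h2 := D.noncrossing y (D.mate x)
    rw [D.mate_mate] at h2
    have a1 := pos_turn x
    have a2 := pos_turn y
    have a3 := pos_turn (D.mate x)
    have a4 := pos_turn (D.mate y)
    omega

/-- The graph obtained by placing an `(m, d)`-diagram `a` to the left of a `(d, e)`-diagram `b`
and identifying the `d` middle points.  Its vertices are the left, middle and right points. -/
def glue {m d e : ℕ} (a : Diagram m d) (b : Diagram d e) :
    SimpleGraph (Fin m ⊕ Fin d ⊕ Fin e) :=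
  SimpleGraph.fromRel fun x y =>
    (∃ p : Fin m ⊕ Fin d, x = Sum.map _root_.id Sum.inl p ∧
      y = Sum.map _root_.id Sum.inl (a.mate p)) ∨
    (∃ p : Fin d ⊕ Fin e, x = Sum.inr p ∧ y = Sum.inr (b.mate p))

/-- The left and right points among the points of a concatenation. -/
def outer {m d e : ℕ} : Fin m ⊕ Fin e → Fin m ⊕ Fin d ⊕ Fin e := Sum.map _root_.id Sum.inr

/-- `c` is the diagram obtained by concatenating `a` and `b` and removing the closed loops: two
outer points are joined in `c` when the links of `a` and `b` connect them. -/
def IsConcat {m d e : ℕ} (a : Diagram m d) (b : Diagram d e) (c : Diagram m e) : Prop :=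
  ∀ x, (glue a b).Reachable (outer x) (outer (c.mate x))

/-- The number of closed loops in the concatenation of `a` and `b`: the connected components that
contain no outer point. -/
noncomputable def loops {m d e : ℕ} (a : Diagram m d) (b : Diagram d e) : ℕ :=
  Nat.card {C : (glue a b).ConnectedComponent //
    ∀ x, (glue a b).connectedComponentMk (outer x) ≠ C}

end Diagram

/-- Formal complex linear combinations of `(m, d)`-diagrams, given by their coefficients. -/
abbrev Comb (m d : ℕ) : Type := Diagram m d → ℂ

/-- The linear combination consisting of a single diagram. -/
noncomputable def single {m d : ℕ} (D : Diagram m d) : Comb m d := Pi.single D 1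

/-- The bilinear extension of the concatenation of diagrams, each closed loop being replaced by a
factor `β`.  For `m = d = e` this is the product of the Temperley–Lieb algebra. -/
noncomputable def comp (β : ℂ) {m d e : ℕ} (x : Comb m d) (y : Comb d e) : Comb m e :=
  open Classical in
  fun c => ∑ a, ∑ b, if Diagram.IsConcat a b c then β ^ Diagram.loops a b * (x a * y b) else 0

/-- The linear extension of the reflection of diagrams. -/
def mirror {m d : ℕ} (x : Comb m d) : Comb d m := fun D => x D.reflect

/-- The linear extension of `Diagram.closeTop`. -/
noncomputable def closeTop {m d : ℕ} (x : Comb m (d + 1)) : Comb (m + 1) d :=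
  ∑ a, x a • single a.closeTop

/-- The generator `E_i` of the Temperley–Lieb algebra on `n` points, the points being counted from
`0` (it is used for `i + 1 < n` only). -/
noncomputable def E (n i : ℕ) : Comb n n :=
  if h : i + 1 < n then single (Diagram.gen i h) else 0

/-- The `q`-number `[m] = (q ^ m - q ^ (-m)) / (q - q ^ (-1))`. -/
noncomputable def qnum (q : ℂ) (m : ℕ) : ℂ := (q ^ m - q⁻¹ ^ m) / (q - q⁻¹)

/-- The Wenzl–Jones projector `P_k` on the `k` bottom points, as an element of the Temperley–Lieb
algebra on `n` points with `β = q + q⁻¹`.  It is used for `k ≤ n`. -/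
noncomputable def wenzlJones (q : ℂ) (n : ℕ) : ℕ → Comb n n
  | 0 => single (Diagram.id n)
  | 1 => single (Diagram.id n)
  | k + 2 =>
    wenzlJones q n (k + 1) - (qnum q (k + 1) / qnum q (k + 2)) •
      comp (q + q⁻¹) (comp (q + q⁻¹) (wenzlJones q n (k + 1)) (E n (n - (k + 2))))
        (wenzlJones q n (k + 1))

/-- The index set of the basis of the cellular module of the boundary seam algebra with `n` bulk
points and `k` boundary points: the monic diagrams with `k + n` left points and `d` right points
without a link between two boundary points, that is, between two of the `k` bottom left points. -/
abbrev SeamDiagram (n k d : ℕ) : Type :=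
  {D : Diagram (k + n) d // D.IsMonic ∧
    ∀ i j : Fin (k + n), n ≤ (i : ℕ) → n ≤ (j : ℕ) → D.mate (Sum.inl i) ≠ Sum.inl j}

noncomputable instance (n k d : ℕ) : Fintype (SeamDiagram n k d) := Fintype.ofFinite _

/-- The basis vector `P_k w`. -/
noncomputable def seamVector (q : ℂ) {n k d : ℕ} (w : SeamDiagram n k d) : Comb (k + n) d :=
  comp (q + q⁻¹) (wenzlJones q (k + n) k) (single w.1)

/-- The Gram matrix: the entry at `(v, w)` is the coefficient of the monic `(d, d)`-diagram, the
identity, in `(P_k v)^* (P_k w)`. -/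
noncomputable def gram (q : ℂ) (n k d : ℕ) : Matrix (SeamDiagram n k d) (SeamDiagram n k d) ℂ :=
  Matrix.of fun v w =>
    comp (q + q⁻¹) (mirror (seamVector q v)) (seamVector q w) (Diagram.id d)

/-- Equality in the cellular module, where diagrams that are not monic are set to zero. -/
def EqModNonMonic {m d : ℕ} (x y : Comb m d) : Prop :=
  ∀ D : Diagram m d, D.IsMonic → x D = y D

/-- The vector obtained from `P_k w`, where `w` has `d + 1` right points, by acting on the right
with the Wenzl–Jones projector `P_{d+1}` on all `d + 1` points and then closing the topmost right
point into an arc that ends at a new left point at the top. -/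
noncomputable def projectedVector (q : ℂ) {n k d : ℕ} (w : SeamDiagram n k (d + 1)) :
    Comb (k + (n + 1)) d :=
  closeTop (comp (q + q⁻¹) (seamVector q w) (wenzlJones q (d + 1) (d + 1)))

end TemperleyLieb

open TemperleyLieb

namespace TemperleyLieb

/-! In the indexing of `mainTheorem6` there are `d + 1` defects, and `cap (d + 1) i` is the monic
diagram whose only left link joins `i` and `i + 1`. Put `c i = (-1) ^ i [d + 2 - i] / [d + 2]`
(`projCoeff`). The vector that replaces the element of `F₂` coming from `x = P_k w` is `addTopL x`
composed with `∑ c i • cap (d + 1) i`. Since `c 0 = 1` and composing with `cap (d + 1) 0` bends the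
topmost right point, the first term is the old basis vector. Every other cap has a through line at
the top, so the remaining terms lie in the image of `addTopL`. They expand in `F₁`, because `P_k`
kills each diagram with a link between two of the `k` bottom points (`compL_seamVector_cap`). This
gives the block `A`.

For the Gram matrix, the two copies of `P_k w` are first multiplied together. What is left is the
coefficient of the identity in a diagram `y` times `∑ c i • cap (d + 1) i`. It vanishes unless `y`
is a reflected cap, and the pairing of caps is tridiagonal, with `β` on the diagonal and `1` beside
it (`compL_cap_apply_id`). The recursion `[m + 2] = β [m + 1] - [m]` says that this tridiagonal
matrix sends `c` to `[d + 3] / [d + 2]` times the first unit vector (`compL_capSum_projCoeff`). A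
diagram with a through line at the top is never `cap (d + 1) 0`, whence the zero blocks; a bent
diagram is `cap (d + 1) 0` only if it comes from the identity, whence the lower right block. Only
`[d + 2] ≠ 0` is used for this.

If `P_{d+2}` exists, the generators annihilate it, so the coefficients of its bent version on the
caps satisfy the same three-term recursion with the same end values as `c`, hence equal `c`
(`closeTopL_wenzlJones`).

Concatenation is defined through connectedness in a graph, so its algebra has to be established
separately. A diagram is encoded by the 0-1 matrix of its compatible two-colourings. Concatenation
becomes matrix multiplication, with a factor 2 for each loop, and both the diagram and the number of
loops can be recovered. Associativity and all diagrammatic identities are then checked on matrices.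
-/

theorem sum_bool_cons {d : ℕ} (f : (Fin (d + 1) → Bool) → ℕ) :
    ∑ u, f u = ∑ b : Bool, ∑ u : Fin d → Bool, f (Fin.cons b u) := by
  rw [← (Fin.consEquiv fun _ : Fin (d + 1) => Bool).sum_comp, Fintype.sum_prod_type]
  rfl

/-! ### Two-colourings of diagrams -/

namespace Diagram

/-- The colouring `(s, t)` of the left and right points is constant on the links of `D`. -/
def Compat {m d : ℕ} (D : Diagram m d) (s : Fin m → Bool) (t : Fin d → Bool) : Prop :=
  ∀ x, Sum.elim s t (D.mate x) = Sum.elim s t x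

open Classical in
/-- The matrix of compatible two-colourings of a diagram. -/
noncomputable def colorMatrix {m d : ℕ} (D : Diagram m d) :
    Matrix (Fin m → Bool) (Fin d → Bool) ℕ :=
  Matrix.of fun s t => if D.Compat s t then 1 else 0

theorem colorMatrix_eq_one {m d : ℕ} {D : Diagram m d} {s t} (h : D.Compat s t) :
    D.colorMatrix s t = 1 := by
  simp [colorMatrix, h]

theorem colorMatrix_eq_zero {m d : ℕ} {D : Diagram m d} {s t} (h : ¬ D.Compat s t) :
    D.colorMatrix s t = 0 := by
  simp [colorMatrix, h]

theorem colorMatrix_ne_zero {m d : ℕ} {D : Diagram m d} {s t} :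
    D.colorMatrix s t ≠ 0 ↔ D.Compat s t := by
  simp [colorMatrix]

theorem colorMatrix_congr {m d m' d' : ℕ} {D : Diagram m d} {D' : Diagram m' d'} {s t s' t'}
    (h : D.Compat s t ↔ D'.Compat s' t') : D.colorMatrix s t = D'.colorMatrix s' t' := by
  classical
  by_cases hs : D.Compat s t
  · rw [colorMatrix_eq_one hs, colorMatrix_eq_one (h.1 hs)]
  · rw [colorMatrix_eq_zero hs, colorMatrix_eq_zero (mt h.2 hs)]

/-- The colouring that is `true` exactly on the link through `x` is compatible, so `y` has to lie on
that link. -/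
theorem mate_eq_of_compat {m d : ℕ} {D : Diagram m d} {x y : Fin m ⊕ Fin d} (hxy : x ≠ y)
    (h : ∀ s t, D.Compat s t → Sum.elim s t x = Sum.elim s t y) : D.mate x = y := by
  classical
  let f : Fin m ⊕ Fin d → Bool := fun z => decide (z = x ∨ z = D.mate x)
  have key := h (f ∘ Sum.inl) (f ∘ Sum.inr) (by
    intro z
    simp only [Sum.elim_comp_inl_inr, f, decide_eq_decide]
    constructor
    · rintro (h | h)
      · right; rw [← h, D.mate_mate]
      · left; rw [← D.mate_mate z, h, D.mate_mate]
    · rintro (h | h)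
      · right; rw [h]
      · left; rw [h, D.mate_mate])
  simp only [Sum.elim_comp_inl_inr, f, true_or, decide_true] at key
  have := of_decide_eq_true key.symm
  rcases this with h | h
  · exact absurd h.symm hxy
  · exact h.symm

theorem ext_of_compat {m d : ℕ} {D D' : Diagram m d}
    (h : ∀ s t, D.Compat s t → D'.Compat s t) : D = D' := by
  ext1
  funext x
  exact mate_eq_of_compat (D'.mate_ne x).symm fun s t hst => (h s t hst x).symm

theorem compat_const {m d : ℕ} (D : Diagram m d) (b : Bool) :
    D.Compat (fun _ => b) (fun _ => b) := by
  intro x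
  have : ∀ y : Fin m ⊕ Fin d, Sum.elim (fun _ => b) (fun _ => b) y = b := by
    rintro (y | y) <;> rfl
  rw [this, this]

/-- The support of the matrix determines the diagram, and the entry at a constant colouring, which
every diagram admits, determines the exponent. This is what turns matrix identities into identities
of diagrams and loop numbers. -/
theorem pow_smul_colorMatrix_inj {m d l l' : ℕ} {D D' : Diagram m d}
    (h : 2 ^ l • D.colorMatrix = 2 ^ l' • D'.colorMatrix) : D = D' ∧ l = l' := by
  have happ : ∀ s t, 2 ^ l * D.colorMatrix s t = 2 ^ l' * D'.colorMatrix s t := by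
    intro s t
    simpa using congrFun (congrFun h s) t
  constructor
  · refine ext_of_compat fun s t hst => ?_
    by_contra hcon
    have := happ s t
    rw [colorMatrix_eq_one hst, colorMatrix_eq_zero hcon] at this
    simp at this
  · have := happ (fun _ => false) (fun _ => false)
    rw [colorMatrix_eq_one (compat_const _ _), colorMatrix_eq_one (compat_const _ _)] at this
    exact Nat.pow_right_injective le_rfl (by simpa using this)

theorem compat_reflect {m d : ℕ} (D : Diagram m d) (s t) :
    D.reflect.Compat s t ↔ D.Compat t s := by
  have hswap : ∀ x : Fin m ⊕ Fin d, Sum.elim s t x.swap = Sum.elim t s x := by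
    rintro (x | x) <;> rfl
  constructor
  · intro h x
    have := h x.swap
    simpa [reflect, hswap] using this
  · intro h x
    have := h x.swap
    have h2 : Sum.elim t s x.swap = Sum.elim s t x := by rcases x with x | x <;> rfl
    simpa [reflect, hswap, h2] using this

theorem compat_id {n : ℕ} (s t : Fin n → Bool) : (Diagram.id n).Compat s t ↔ s = t := by
  constructor
  · intro h
    funext i
    exact h (Sum.inr i)
  · rintro rfl (x | x) <;> rfl

theorem elim_shift {m d : ℕ} (s : Fin (m + 1) → Bool) (t : Fin (d + 1) → Bool)
    (x : Fin m ⊕ Fin d) : Sum.elim s t (shift x) = Sum.elim (Fin.tail s) (Fin.tail t) x := by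
  rcases x with x | x <;> rfl

theorem compat_addTop {m d : ℕ} (D : Diagram m d) (s t) :
    D.addTop.Compat s t ↔ s 0 = t 0 ∧ D.Compat (Fin.tail s) (Fin.tail t) := by
  constructor
  · intro h
    refine ⟨h (Sum.inr 0), fun x => ?_⟩
    have := h (shift x)
    simpa [addTop, elim_shift] using this
  · rintro ⟨h0, h⟩ x
    rcases shift_cases x with rfl | rfl | ⟨y, rfl⟩
    · exact h0.symm
    · exact h0
    · simpa [addTop, elim_shift] using h y

theorem elim_turn {m d : ℕ} (s : Fin (m + 1) → Bool) (t : Fin d → Bool)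
    (x : Fin m ⊕ Fin (d + 1)) :
    Sum.elim s t (turn x) =
      Sum.elim (Fin.tail s) (Fin.cons (s 0) t : Fin (d + 1) → Bool) x := by
  rcases x with x | x
  · rfl
  · refine Fin.cases rfl (fun _ => rfl) x

theorem compat_closeTop {m d : ℕ} (D : Diagram m (d + 1)) (s t) :
    D.closeTop.Compat s t ↔ D.Compat (Fin.tail s) (Fin.cons (s 0) t : Fin (d + 1) → Bool) := by
  constructor
  · intro h x
    have := h (turn x)
    simpa [closeTop, elim_turn] using this
  · intro h x
    obtain ⟨y, rfl⟩ := turn.surjective x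
    simpa [closeTop, elim_turn] using h y

/-! ### Disjoint unions and partial traces -/

/-- The disjoint union of a diagram without right points and a diagram without left points. -/
def union {m e : ℕ} (a : Diagram m 0) (b : Diagram 0 e) : Diagram m e where
  mate := Sum.elim
    (fun i => Sum.inl (Sum.elim _root_.id Fin.elim0 (a.mate (Sum.inl i))))
    (fun j => Sum.inr (Sum.elim Fin.elim0 _root_.id (b.mate (Sum.inr j))))
  mate_mate := by
    rintro (x | x)
    · have := a.mate_mate (Sum.inl x)
      rcases h : a.mate (Sum.inl x) with y | y
      · rw [h] at this
        simp [h, this]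
      · exact y.elim0
    · have := b.mate_mate (Sum.inr x)
      rcases h : b.mate (Sum.inr x) with y | y
      · exact y.elim0
      · rw [h] at this
        simp [h, this]
  mate_ne := by
    rintro (x | x) hx
    · have := a.mate_ne (Sum.inl x)
      rcases h : a.mate (Sum.inl x) with y | y
      · rw [h] at this
        simp [h] at hx this
        exact this hx
      · exact y.elim0
    · have := b.mate_ne (Sum.inr x)
      rcases h : b.mate (Sum.inr x) with y | y
      · exact y.elim0
      · rw [h] at this
        simp [h] at hx this
        exact this hx
  noncrossing := by
    rintro (x | x) (y | y)
    · have := a.noncrossing (Sum.inl x) (Sum.inl y)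
      rcases h : a.mate (Sum.inl x) with z | z
      · rcases h' : a.mate (Sum.inl y) with w | w
        · rw [h, h'] at this
          simpa [h, h', pos] using this
        · exact w.elim0
      · exact z.elim0
    · rcases h : a.mate (Sum.inl x) with z | z
      · simp only [Sum.elim_inl, h, Sum.elim_inr, pos, _root_.id]; omega
      · exact z.elim0
    · rcases h : a.mate (Sum.inl y) with z | z
      · simp only [Sum.elim_inl, h, Sum.elim_inr, pos, _root_.id]; omega
      · exact z.elim0
    · have := b.noncrossing (Sum.inr x) (Sum.inr y)
      rcases h : b.mate (Sum.inr x) with z | z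
      · exact z.elim0
      · rcases h' : b.mate (Sum.inr y) with w | w
        · exact w.elim0
        · rw [h, h'] at this
          simp only [pos] at this
          simp only [Sum.elim_inr, h, h', pos, _root_.id]
          omega

theorem compat_union {m e : ℕ} (a : Diagram m 0) (b : Diagram 0 e) (s u t) :
    (a.union b).Compat s t ↔ a.Compat s u ∧ b.Compat u t := by
  have ha : ∀ i, Sum.elim s t ((a.union b).mate (Sum.inl i)) =
      Sum.elim s u (a.mate (Sum.inl i)) := by
    intro i
    rcases h : a.mate (Sum.inl i) with y | y
    · simp [union, h]
    · exact y.elim0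
  have hb : ∀ i, Sum.elim s t ((a.union b).mate (Sum.inr i)) =
      Sum.elim u t (b.mate (Sum.inr i)) := by
    intro i
    rcases h : b.mate (Sum.inr i) with y | y
    · exact y.elim0
    · simp [union, h]
  constructor
  · intro h
    refine ⟨?_, ?_⟩
    · rintro (x | x)
      · rw [← ha]; exact h _
      · exact x.elim0
    · rintro (x | x)
      · exact x.elim0
      · rw [← hb]; exact h _
  · rintro ⟨h1, h2⟩ (x | x)
    · rw [ha]; exact h1 _
    · rw [hb]; exact h2 _

/-- The partner of a point after the top left and the top right points have been joined. -/
noncomputable def hop {m e : ℕ} (D : Diagram (m + 1) (e + 1)) (x : Fin (m + 1) ⊕ Fin (e + 1)) :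
    Fin (m + 1) ⊕ Fin (e + 1) :=
  if D.mate x = Sum.inl 0 then D.mate (Sum.inr 0)
  else if D.mate x = Sum.inr 0 then D.mate (Sum.inl 0) else D.mate x

theorem hop_cases {m e : ℕ} (D : Diagram (m + 1) (e + 1)) (x : Fin (m + 1) ⊕ Fin (e + 1)) :
    (D.mate x = Sum.inl 0 ∧ D.mate (Sum.inl 0) = x ∧ D.hop x = D.mate (Sum.inr 0)) ∨
    (D.mate x = Sum.inr 0 ∧ D.mate (Sum.inr 0) = x ∧ D.hop x = D.mate (Sum.inl 0)) ∨
    (D.mate x ≠ Sum.inl 0 ∧ D.mate x ≠ Sum.inr 0 ∧ D.hop x = D.mate x) := by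
  unfold hop
  split_ifs with h1 h2
  · left; exact ⟨h1, by rw [← h1, D.mate_mate], rfl⟩
  · right; left; exact ⟨h2, by rw [← h2, D.mate_mate], rfl⟩
  · right; right; exact ⟨h1, h2, rfl⟩

theorem shift_ne_inl_zero {m d : ℕ} (x : Fin m ⊕ Fin d) : shift x ≠ Sum.inl 0 := by
  rcases x with x | x <;> simp [shift]

theorem shift_ne_inr_zero {m d : ℕ} (x : Fin m ⊕ Fin d) : shift x ≠ Sum.inr 0 := by
  rcases x with x | x <;> simp [shift]

theorem exists_shift_eq_hop {m e : ℕ} (D : Diagram (m + 1) (e + 1)) (x : Fin m ⊕ Fin e) :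
    ∃ y, shift y = D.hop (shift x) := by
  have h1 := shift_ne_inl_zero x
  have h2 := shift_ne_inr_zero x
  have hl := D.mate_ne (Sum.inl 0)
  have hr := D.mate_ne (Sum.inr 0)
  have hll := D.mate_mate (Sum.inl 0)
  have hrr := D.mate_mate (Sum.inr 0)
  have key : D.hop (shift x) ≠ Sum.inl 0 ∧ D.hop (shift x) ≠ Sum.inr 0 := by
    rcases D.hop_cases (shift x) with ⟨a, b, c⟩ | ⟨a, b, c⟩ | ⟨a, b, c⟩
    · rw [c]
      refine ⟨fun h => ?_, hr⟩
      rw [h, b] at hrr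
      exact h2 hrr
    · rw [c]
      refine ⟨hl, fun h => ?_⟩
      rw [h, b] at hll
      exact h1 hll
    · rw [c]; exact ⟨a, b⟩
  rcases shift_cases (D.hop (shift x)) with h | h | ⟨y, h⟩
  · exact absurd h key.1
  · exact absurd h key.2
  · exact ⟨y, h.symm⟩

theorem hop_hop {m e : ℕ} (D : Diagram (m + 1) (e + 1)) (x : Fin (m + 1) ⊕ Fin (e + 1))
    (h1 : x ≠ Sum.inl 0) (h2 : x ≠ Sum.inr 0) : D.hop (D.hop x) = x := by
  have hll := D.mate_mate (Sum.inl 0)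
  have hrr := D.mate_mate (Sum.inr 0)
  have hx := D.mate_mate x
  rcases D.hop_cases x with ⟨a, b, c⟩ | ⟨a, b, c⟩ | ⟨a, b, c⟩
  · rw [c]
    unfold hop
    simp [hrr, b]
  · rw [c]
    unfold hop
    simp [hll, b]
  · rw [c]
    unfold hop
    simp [hx, h1, h2]

theorem hop_ne {m e : ℕ} (D : Diagram (m + 1) (e + 1)) (x : Fin (m + 1) ⊕ Fin (e + 1)) :
    D.hop x ≠ x := by
  have hll := D.mate_mate (Sum.inl 0)
  have hrr := D.mate_mate (Sum.inr 0)
  rcases D.hop_cases x with ⟨a, b, c⟩ | ⟨a, b, c⟩ | ⟨a, b, c⟩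
  · rw [c]
    intro h
    rw [h, a] at hrr
    simp at hrr
  · rw [c]
    intro h
    rw [h, a] at hll
    simp at hll
  · rw [c]; exact D.mate_ne x

/-- The two top points are the first and the last in the boundary order. If the links at `x` and `y`
both run to top points, then `x = y` or `hop x = y` and the inequalities fail; in the other cases a
crossing would already be present among the original links. -/
theorem hop_noncrossing {m e : ℕ} (D : Diagram (m + 1) (e + 1))
    (x y : Fin (m + 1) ⊕ Fin (e + 1)) (hx : 0 < pos x)
    (hy' : pos (D.hop y) < m + e + 1) :
    ¬ (pos x < pos y ∧ pos y < pos (D.hop x) ∧ pos (D.hop x) < pos (D.hop y)) := by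
  have pl : pos (Sum.inl 0 : Fin (m + 1) ⊕ Fin (e + 1)) = 0 := rfl
  have pr : pos (Sum.inr 0 : Fin (m + 1) ⊕ Fin (e + 1)) = m + 1 + e := pos_inr_zero
  have hll := D.mate_mate (Sum.inl 0)
  have hrr := D.mate_mate (Sum.inr 0)
  have hxx := D.mate_mate x
  have hyy := D.mate_mate y
  rcases D.hop_cases x with ⟨a, b, c⟩ | ⟨a, b, c⟩ | ⟨a, b, c⟩ <;>
  rcases D.hop_cases y with ⟨a', b', c'⟩ | ⟨a', b', c'⟩ | ⟨a', b', c'⟩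
  · rw [← b, ← b']; omega
  · rw [c, b']; omega
  · have := D.noncrossing y (D.mate (Sum.inr 0))
    rw [hrr] at this
    rw [c]
    rw [c'] at hy' ⊢
    omega
  · rw [c, b']; omega
  · rw [← b, ← b']; omega
  · have := D.noncrossing (Sum.inl 0) y
    rw [c]
    rw [c'] at hy' ⊢
    omega
  · have := D.noncrossing x y
    have := D.noncrossing x (D.mate (Sum.inr 0))
    have := D.noncrossing (Sum.inl 0) x
    rw [a'] at *
    rw [b'] at *
    rw [c]
    rw [c'] at hy' ⊢
    omega
  · have := D.noncrossing x y
    rw [a'] at this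
    rw [c]
    rw [c'] at hy' ⊢
    omega
  · have := D.noncrossing x y
    rw [c]
    rw [c'] at hy' ⊢
    omega

/-- The partial trace: the top left point is joined to the top right point. -/
noncomputable def ptr {m e : ℕ} (D : Diagram (m + 1) (e + 1)) : Diagram m e where
  mate x := (D.exists_shift_eq_hop x).choose
  mate_mate x := by
    apply shift_injective
    rw [(D.exists_shift_eq_hop _).choose_spec, (D.exists_shift_eq_hop x).choose_spec]
    exact D.hop_hop _ (shift_ne_inl_zero x) (shift_ne_inr_zero x)
  mate_ne x h := by
    have := (D.exists_shift_eq_hop x).choose_spec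
    rw [h] at this
    exact D.hop_ne _ this.symm
  noncrossing x y := by
    have hx := (D.exists_shift_eq_hop x).choose_spec
    have hy := (D.exists_shift_eq_hop y).choose_spec
    have px := congrArg pos hx
    have py := congrArg pos hy
    rw [pos_shift] at px py
    have ly := pos_lt (D.exists_shift_eq_hop y).choose
    have := D.hop_noncrossing (shift x) (shift y) (by rw [pos_shift]; omega) (by omega)
    rw [pos_shift, pos_shift, ← px, ← py] at this
    omega

theorem shift_ptr_mate {m e : ℕ} (D : Diagram (m + 1) (e + 1)) (x : Fin m ⊕ Fin e) :
    shift (D.ptr.mate x) = D.hop (shift x) :=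
  (D.exists_shift_eq_hop x).choose_spec

/-! ### Products of colour matrices -/

theorem colorMatrix_mul_apply {m d e : ℕ} (a : Diagram m d) (b : Diagram d e) (s t) :
    (a.colorMatrix * b.colorMatrix) s t = ∑ u, a.colorMatrix s u * b.colorMatrix u t :=
  Matrix.mul_apply

theorem colorMatrix_closeTop {m d : ℕ} (D : Diagram m (d + 1)) (s : Fin m → Bool) (b : Bool)
    (t : Fin d → Bool) :
    D.closeTop.colorMatrix (Fin.cons b s : Fin (m + 1) → Bool) t =
      D.colorMatrix s (Fin.cons b t : Fin (d + 1) → Bool) := by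
  apply colorMatrix_congr
  rw [compat_closeTop]
  simp

theorem colorMatrix_reflect {m d : ℕ} (D : Diagram m d) (s t) :
    D.reflect.colorMatrix s t = D.colorMatrix t s :=
  colorMatrix_congr (compat_reflect D s t)

theorem colorMatrix_addTop {m d : ℕ} (D : Diagram m d) (s : Fin m → Bool) (b c : Bool)
    (t : Fin d → Bool) :
    D.addTop.colorMatrix (Fin.cons b s : Fin (m + 1) → Bool) (Fin.cons c t : Fin (d + 1) → Bool) =
      if b = c then D.colorMatrix s t else 0 := by
  split_ifs with h
  · apply colorMatrix_congr
    rw [compat_addTop]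
    simp [h]
  · apply colorMatrix_eq_zero
    rw [compat_addTop]
    simp [h]

theorem compat_ptr_of_compat {m e : ℕ} (D : Diagram (m + 1) (e + 1)) {s : Fin m → Bool}
    {t : Fin e → Bool} {b : Bool}
    (h : D.Compat (Fin.cons b s : Fin (m + 1) → Bool) (Fin.cons b t : Fin (e + 1) → Bool)) :
    D.ptr.Compat s t := by
  intro x
  have e1 : ∀ y : Fin m ⊕ Fin e, Sum.elim s t y =
      Sum.elim (Fin.cons b s : Fin (m + 1) → Bool) (Fin.cons b t : Fin (e + 1) → Bool)
        (shift y) := by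
    intro y; rw [elim_shift]; simp
  rw [e1, e1, shift_ptr_mate]
  have hl := h (Sum.inl 0)
  have hr := h (Sum.inr 0)
  have hx := h (shift x)
  rcases D.hop_cases (shift x) with ⟨a1, a2, a3⟩ | ⟨a1, a2, a3⟩ | ⟨a1, a2, a3⟩
  · rw [a3, hr]
    rw [a1] at hx
    exact hx
  · rw [a3, hl]
    rw [a1] at hx
    exact hx
  · rw [a3, hx]

theorem compat_of_compat_ptr {m e : ℕ} (D : Diagram (m + 1) (e + 1)) {s : Fin m → Bool}
    {t : Fin e → Bool} {b : Bool} (h : D.ptr.Compat s t)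
    (hb : ∀ x, D.mate (shift x) = Sum.inl 0 ∨ D.mate (shift x) = Sum.inr 0 →
      Sum.elim s t x = b) :
    D.Compat (Fin.cons b s : Fin (m + 1) → Bool) (Fin.cons b t : Fin (e + 1) → Bool) := by
  have e1 : ∀ y : Fin m ⊕ Fin e, Sum.elim s t y =
      Sum.elim (Fin.cons b s : Fin (m + 1) → Bool) (Fin.cons b t : Fin (e + 1) → Bool)
        (shift y) := by
    intro y; rw [elim_shift]; simp
  have hl : Sum.elim (Fin.cons b s : Fin (m + 1) → Bool) (Fin.cons b t : Fin (e + 1) → Bool)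
    (Sum.inl 0) = b := rfl
  have hr : Sum.elim (Fin.cons b s : Fin (m + 1) → Bool) (Fin.cons b t : Fin (e + 1) → Bool)
    (Sum.inr 0) = b := rfl
  intro x
  rcases shift_cases x with rfl | rfl | ⟨x, rfl⟩
  · rw [hl]
    rcases shift_cases (D.mate (Sum.inl 0)) with h' | h' | ⟨y, hy⟩
    · rw [h', hl]
    · rw [h', hr]
    · rw [hy, ← e1]
      exact hb y (Or.inl (by rw [← hy, D.mate_mate]))
  · rw [hr]
    rcases shift_cases (D.mate (Sum.inr 0)) with h' | h' | ⟨y, hy⟩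
    · rw [h', hl]
    · rw [h', hr]
    · rw [hy, ← e1]
      exact hb y (Or.inr (by rw [← hy, D.mate_mate]))
  · rcases D.hop_cases (shift x) with ⟨a1, a2, a3⟩ | ⟨a1, a2, a3⟩ | ⟨a1, a2, a3⟩
    · rw [← e1, hb x (Or.inl a1), a1, hl]
    · rw [← e1, hb x (Or.inr a1), a1, hr]
    · rw [← a3, ← shift_ptr_mate, ← e1, ← e1]
      exact h x

/-- The summation index is the colour of the arc added by the trace. It is free if the two top
points were already joined, so that the arc closes a loop; otherwise it is forced by the other end
of the link at the top left point. -/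
theorem exists_sum_ptr {m e : ℕ} (D : Diagram (m + 1) (e + 1)) :
    ∃ l : ℕ, ∀ s t, ∑ b : Bool, D.colorMatrix (Fin.cons b s : Fin (m + 1) → Bool)
      (Fin.cons b t : Fin (e + 1) → Bool) = 2 ^ l * D.ptr.colorMatrix s t := by
  by_cases hD : D.mate (Sum.inl 0) = Sum.inr 0
  · refine ⟨1, fun s t => ?_⟩
    by_cases h : D.ptr.Compat s t
    · have : ∀ b : Bool, D.colorMatrix (Fin.cons b s : Fin (m + 1) → Bool)
          (Fin.cons b t : Fin (e + 1) → Bool) = 1 := by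
        intro b
        apply colorMatrix_eq_one
        apply D.compat_of_compat_ptr h
        rintro x (hx | hx)
        · have := D.mate_mate (shift x)
          rw [hx, hD] at this
          exact absurd this.symm (shift_ne_inr_zero x)
        · have := D.mate_mate (shift x)
          rw [hx, ← hD, D.mate_mate] at this
          exact absurd this.symm (shift_ne_inl_zero x)
      simp [this, colorMatrix_eq_one h]
    · have : ∀ b : Bool, D.colorMatrix (Fin.cons b s : Fin (m + 1) → Bool)
          (Fin.cons b t : Fin (e + 1) → Bool) = 0 :=
        fun b => colorMatrix_eq_zero fun hc => h (D.compat_ptr_of_compat hc)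
      simp [this, colorMatrix_eq_zero h]
  · refine ⟨0, fun s t => ?_⟩
    by_cases h : D.ptr.Compat s t
    · obtain ⟨y, hy⟩ : ∃ y, D.mate (Sum.inl 0) = shift y := by
        rcases shift_cases (D.mate (Sum.inl 0)) with h' | h' | h'
        · exact absurd h' (D.mate_ne _)
        · exact absurd h' hD
        · exact h'
      have hy' : D.mate (shift y) = Sum.inl 0 := by rw [← hy, D.mate_mate]
      have hone : D.colorMatrix (Fin.cons (Sum.elim s t y) s : Fin (m + 1) → Bool)
          (Fin.cons (Sum.elim s t y) t : Fin (e + 1) → Bool) = 1 := by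
        apply colorMatrix_eq_one
        apply D.compat_of_compat_ptr h
        rintro x (hx | hx)
        · have : x = y := by
            apply shift_injective
            rw [← D.mate_mate (shift x), hx, hy]
          rw [this]
        · have : D.ptr.mate x = y := by
            apply shift_injective
            rw [shift_ptr_mate]
            unfold hop
            simp [hx, hy]
          rw [← this]
          exact (h x).symm
      rw [Finset.sum_eq_single (Sum.elim s t y), hone, colorMatrix_eq_one h]
      · rfl
      · intro b _ hb
        apply colorMatrix_eq_zero
        intro hc
        have := hc (Sum.inl 0)
        rw [hy, elim_shift] at this
        simp only [Fin.tail_cons, Sum.elim_inl, Fin.cons_zero] at this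
        exact hb this.symm
      · simp
    · have : ∀ b : Bool, D.colorMatrix (Fin.cons b s : Fin (m + 1) → Bool)
          (Fin.cons b t : Fin (e + 1) → Bool) = 0 :=
        fun b => colorMatrix_eq_zero fun hc => h (D.compat_ptr_of_compat hc)
      simp [this, colorMatrix_eq_zero h]

/-- Induction on the number of middle points: the topmost one is bent outwards on both factors,
which leaves one middle point fewer, and the partial trace then rejoins the two bent ends. -/
theorem exists_colorMatrix_mul {m d e : ℕ} (a : Diagram m d) (b : Diagram d e) :
    ∃ (c : Diagram m e) (l : ℕ), a.colorMatrix * b.colorMatrix = 2 ^ l • c.colorMatrix := by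
  induction d generalizing m e with
  | zero =>
    refine ⟨a.union b, 0, ?_⟩
    ext s t
    rw [colorMatrix_mul_apply,
      Fintype.sum_eq_single Fin.elim0 (fun u hu => absurd (Subsingleton.elim _ _) hu),
      pow_zero, one_smul]
    by_cases h : (a.union b).Compat s t
    · have := (compat_union a b s Fin.elim0 t).1 h
      rw [colorMatrix_eq_one h, colorMatrix_eq_one this.1, colorMatrix_eq_one this.2]
    · rw [colorMatrix_eq_zero h]
      rw [compat_union a b s Fin.elim0 t, not_and_or] at h
      rcases h with h | h
      · rw [colorMatrix_eq_zero h, zero_mul]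
      · rw [colorMatrix_eq_zero h, mul_zero]
  | succ d ih =>
    obtain ⟨c, l, hc⟩ := ih a.closeTop b.reflect.closeTop.reflect
    obtain ⟨l', hl'⟩ := c.exists_sum_ptr
    refine ⟨c.ptr, l + l', ?_⟩
    ext s t
    have key : ∀ x : Bool, ∑ u : Fin d → Bool,
        a.colorMatrix s (Fin.cons x u : Fin (d + 1) → Bool) *
          b.colorMatrix (Fin.cons x u : Fin (d + 1) → Bool) t =
        2 ^ l * c.colorMatrix (Fin.cons x s : Fin (m + 1) → Bool)
          (Fin.cons x t : Fin (e + 1) → Bool) := by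
      intro x
      have := congrFun (congrFun hc (Fin.cons x s)) (Fin.cons x t)
      rw [colorMatrix_mul_apply] at this
      simp only [colorMatrix_closeTop, colorMatrix_reflect] at this
      rw [this]
      rfl
    rw [colorMatrix_mul_apply, sum_bool_cons]
    simp only [key]
    rw [← Finset.mul_sum, hl', Matrix.smul_apply, smul_eq_mul, pow_add, mul_assoc]

/-! ### Colourings and the graph that defines concatenation -/

/-- The colouring of the points of a concatenation with the given colours of the left, middle and
right points. -/
def glueColor {m d e : ℕ} (s : Fin m → Bool) (u : Fin d → Bool) (t : Fin e → Bool) :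
    Fin m ⊕ Fin d ⊕ Fin e → Bool :=
  Sum.elim s (Sum.elim u t)

theorem compat_iff_glue {m d e : ℕ} (a : Diagram m d) (b : Diagram d e) (s u t) :
    a.Compat s u ∧ b.Compat u t ↔
      ∀ x y, (glue a b).Adj x y → glueColor s u t x = glueColor s u t y := by
  have hl : ∀ p : Fin m ⊕ Fin d,
      glueColor s u t (Sum.map _root_.id Sum.inl p) = Sum.elim s u p := by
    rintro (p | p) <;> rfl
  constructor
  · rintro ⟨h1, h2⟩ x y hxy
    simp only [glue, SimpleGraph.fromRel_adj] at hxy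
    obtain ⟨-, (⟨p, rfl, rfl⟩ | ⟨p, rfl, rfl⟩) | (⟨p, rfl, rfl⟩ | ⟨p, rfl, rfl⟩)⟩ := hxy
    · rw [hl, hl]; exact (h1 p).symm
    · exact (h2 p).symm
    · rw [hl, hl]; exact h1 p
    · exact h2 p
  · intro h
    constructor
    · intro p
      rw [← hl, ← hl]
      refine h _ _ ?_
      simp only [glue, SimpleGraph.fromRel_adj]
      refine ⟨fun hc => ?_, Or.inr (Or.inl ⟨p, rfl, rfl⟩)⟩
      exact a.mate_ne p ((Sum.map_injective.2 ⟨Function.injective_id, Sum.inl_injective⟩) hc)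
    · intro p
      refine h (Sum.inr _) (Sum.inr _) ?_
      simp only [glue, SimpleGraph.fromRel_adj]
      refine ⟨fun hc => ?_, Or.inr (Or.inr ⟨p, rfl, rfl⟩)⟩
      exact b.mate_ne p (Sum.inr_injective hc)

/-- For the converse, the indicator function of the component of `x` serves as the test colouring.
-/
theorem reachable_iff_color {V : Type*} (G : SimpleGraph V) (x y : V) :
    G.Reachable x y ↔ ∀ f : V → Bool, (∀ v w, G.Adj v w → f v = f w) → f x = f y := by
  classical
  constructor
  · rintro ⟨p⟩ f hf
    induction p with
    | nil => rfl
    | cons h _ ih => exact (hf _ _ h).trans ih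
  · intro h
    have := h (fun v => decide (G.Reachable x v)) (by
      intro v w hvw
      simp only [decide_eq_decide]
      exact ⟨fun h => h.trans hvw.reachable, fun h => h.trans hvw.symm.reachable⟩)
    simpa using this

theorem isConcat_iff_compat {m d e : ℕ} (a : Diagram m d) (b : Diagram d e) (c : Diagram m e) :
    IsConcat a b c ↔ ∀ s u t, a.Compat s u → b.Compat u t → c.Compat s t := by
  have ho : ∀ (s : Fin m → Bool) (u : Fin d → Bool) (t : Fin e → Bool) (x : Fin m ⊕ Fin e),
      glueColor s u t (outer x) = Sum.elim s t x := by
    rintro s u t (x | x) <;> rfl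
  simp only [IsConcat, reachable_iff_color]
  constructor
  · intro h s u t h1 h2 x
    have := h x (glueColor s u t) ((compat_iff_glue a b s u t).1 ⟨h1, h2⟩)
    rw [ho, ho] at this
    exact this.symm
  · intro h x f hf
    obtain ⟨s, u, t, rfl⟩ : ∃ s u t, f = glueColor s u t :=
      ⟨f ∘ Sum.inl, f ∘ Sum.inr ∘ Sum.inl, f ∘ Sum.inr ∘ Sum.inr, by
        funext x
        rcases x with x | x | x <;> rfl⟩
    obtain ⟨h1, h2⟩ := (compat_iff_glue a b s u t).2 hf
    rw [ho, ho]
    exact (h s u t h1 h2 x).symm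

/-- Components that meet an outer point are forced to be `false`; the others are the closed loops,
and each of them is coloured freely. -/
theorem card_compat_false {m d e : ℕ} (a : Diagram m d) (b : Diagram d e) :
    Nat.card {u : Fin d → Bool // a.Compat (fun _ => false) u ∧ b.Compat u (fun _ => false)} =
      2 ^ loops a b := by
  classical
  let S := {C : (glue a b).ConnectedComponent //
    ∀ x, (glue a b).connectedComponentMk (outer x) ≠ C}
  have hS : Nat.card (S → Bool) = 2 ^ loops a b := by
    rw [Nat.card_fun]
    simp [loops, S]
  rw [← hS]
  refine (Nat.card_congr (Equiv.ofBijective (fun g : S → Bool => ?_) ?_)).symm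
  · let f : Fin m ⊕ Fin d ⊕ Fin e → Bool := fun v =>
      if h : ∀ x, (glue a b).connectedComponentMk (outer x) ≠ (glue a b).connectedComponentMk v
      then g ⟨_, h⟩ else false
    refine ⟨fun i => f (Sum.inr (Sum.inl i)), ?_⟩
    rw [compat_iff_glue]
    have hf : glueColor (fun _ : Fin m => false) (fun i => f (Sum.inr (Sum.inl i)))
        (fun _ : Fin e => false) = f := by
      funext v
      rcases v with v | v | v
      · have : ¬ ∀ x, (glue a b).connectedComponentMk (outer x) ≠
            (glue a b).connectedComponentMk (Sum.inl v) := by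
          push Not
          exact ⟨Sum.inl v, rfl⟩
        simp only [f, dif_neg this]
        rfl
      · rfl
      · have : ¬ ∀ x, (glue a b).connectedComponentMk (outer x) ≠
            (glue a b).connectedComponentMk (Sum.inr (Sum.inr v)) := by
          push Not
          exact ⟨Sum.inr v, rfl⟩
        simp only [f, dif_neg this]
        rfl
    rw [hf]
    intro x y hxy
    have : (glue a b).connectedComponentMk x = (glue a b).connectedComponentMk y :=
      SimpleGraph.ConnectedComponent.sound hxy.reachable
    simp only [f, this]
  · constructor
    · intro g g' hgg
      funext ⟨C, hC⟩
      have hgg' := congrArg Subtype.val hgg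
      induction C using SimpleGraph.ConnectedComponent.ind with
      | h v =>
        rcases v with v | v | v
        · exact absurd rfl (hC (Sum.inl v))
        · have := congrFun hgg' v
          simp only [dif_pos hC] at this
          exact this
        · exact absurd rfl (hC (Sum.inr v))
    · rintro ⟨u, hu⟩
      rw [compat_iff_glue] at hu
      have hr : ∀ v w, (glue a b).Reachable v w →
          glueColor (fun _ : Fin m => false) u (fun _ : Fin e => false) v =
          glueColor (fun _ : Fin m => false) u (fun _ : Fin e => false) w :=
        fun v w h => (reachable_iff_color _ v w).1 h _ hu
      refine ⟨fun C => C.1.lift (glueColor (fun _ : Fin m => false) u (fun _ : Fin e => false))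
        (fun v w p _ => hr v w p.reachable), ?_⟩
      apply Subtype.ext
      funext i
      simp only
      split_ifs with h
      · rfl
      · push Not at h
        obtain ⟨x, hx⟩ := h
        have := hr _ _ (SimpleGraph.ConnectedComponent.exact hx)
        rcases x with x | x
        · exact this
        · exact this

theorem loops_eq {m d e : ℕ} {a : Diagram m d} {b : Diagram d e} {c : Diagram m e} {l : ℕ}
    (h : a.colorMatrix * b.colorMatrix = 2 ^ l • c.colorMatrix) : loops a b = l := by
  classical
  have h1 := congrFun (congrFun h fun _ => false) fun _ => false
  have h2 : (a.colorMatrix * b.colorMatrix) (fun _ => false) (fun _ => false) =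
      2 ^ loops a b := by
    rw [← card_compat_false, colorMatrix_mul_apply, Nat.card_eq_fintype_card,
      Fintype.card_subtype, Finset.card_filter]
    refine Finset.sum_congr rfl fun u _ => ?_
    by_cases h1 : a.Compat (fun _ => false) u
    · by_cases h2 : b.Compat u (fun _ => false)
      · simp [h1, h2, colorMatrix_eq_one]
      · simp [h2, colorMatrix_eq_zero]
    · simp [h1, colorMatrix_eq_zero]
  rw [h2] at h1
  have h3 : (2 ^ l • c.colorMatrix) (fun _ => false) (fun _ => false) = 2 ^ l := by
    simp [colorMatrix_eq_one (compat_const c false)]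
  rw [h3] at h1
  exact Nat.pow_right_injective le_rfl h1

/-- The concatenation of two diagrams, without the closed loops. -/
noncomputable def concat {m d e : ℕ} (a : Diagram m d) (b : Diagram d e) : Diagram m e :=
  (exists_colorMatrix_mul a b).choose

theorem colorMatrix_mul {m d e : ℕ} (a : Diagram m d) (b : Diagram d e) :
    a.colorMatrix * b.colorMatrix = 2 ^ loops a b • (concat a b).colorMatrix := by
  obtain ⟨l, hl⟩ := (exists_colorMatrix_mul a b).choose_spec
  rw [loops_eq hl]
  exact hl

theorem concat_eq {m d e : ℕ} {a : Diagram m d} {b : Diagram d e} {c : Diagram m e} {l : ℕ}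
    (h : a.colorMatrix * b.colorMatrix = 2 ^ l • c.colorMatrix) :
    concat a b = c ∧ loops a b = l :=
  pow_smul_colorMatrix_inj ((colorMatrix_mul a b).symm.trans h)

theorem compat_concat {m d e : ℕ} (a : Diagram m d) (b : Diagram d e) (s t) :
    (concat a b).Compat s t ↔ ∃ u, a.Compat s u ∧ b.Compat u t := by
  have h := congrFun (congrFun (colorMatrix_mul a b) s) t
  rw [← colorMatrix_ne_zero]
  have h' : (a.colorMatrix * b.colorMatrix) s t ≠ 0 ↔ (concat a b).colorMatrix s t ≠ 0 := by
    rw [h, Matrix.smul_apply, smul_eq_mul]; simp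
  rw [← h', colorMatrix_mul_apply]
  rw [Ne, Finset.sum_eq_zero_iff]
  push Not
  simp only [Finset.mem_univ, true_and, mul_ne_zero_iff, colorMatrix_ne_zero]

/-- `isConcat_iff_compat` yields only an inclusion of sets of colourings, but by `ext_of_compat` an
inclusion already forces the diagrams to coincide. -/
theorem isConcat_iff {m d e : ℕ} (a : Diagram m d) (b : Diagram d e) (c : Diagram m e) :
    IsConcat a b c ↔ concat a b = c := by
  rw [isConcat_iff_compat]
  constructor
  · intro h
    refine ext_of_compat fun s t hst => ?_
    obtain ⟨u, h1, h2⟩ := (compat_concat a b s t).1 hst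
    exact h s u t h1 h2
  · rintro rfl s u t h1 h2
    exact (compat_concat a b s t).2 ⟨u, h1, h2⟩

/-! ### Concatenation, through lines, bending and reflection -/

theorem exists_cons {d : ℕ} (s : Fin (d + 1) → Bool) :
    ∃ (b : Bool) (s' : Fin d → Bool), s = Fin.cons b s' :=
  ⟨s 0, Fin.tail s, (Fin.cons_self_tail s).symm⟩

theorem colorMatrix_mul_eq {m d e : ℕ} (a : Diagram m d) (b : Diagram d e) (s t) :
    ∑ u, a.colorMatrix s u * b.colorMatrix u t =
      2 ^ loops a b * (concat a b).colorMatrix s t := by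
  rw [← colorMatrix_mul_apply, colorMatrix_mul, Matrix.smul_apply, smul_eq_mul]

theorem concat_eq_of_sum {m d e l : ℕ} {a : Diagram m d} {b : Diagram d e} {c : Diagram m e}
    (h : ∀ s t, ∑ u, a.colorMatrix s u * b.colorMatrix u t = 2 ^ l * c.colorMatrix s t) :
    concat a b = c ∧ loops a b = l := by
  apply concat_eq
  ext s t
  rw [colorMatrix_mul_apply, Matrix.smul_apply, smul_eq_mul]
  exact h s t

theorem concat_addTop {m d e : ℕ} (a : Diagram m d) (b : Diagram d e) :
    concat a.addTop b.addTop = (concat a b).addTop ∧ loops a.addTop b.addTop = loops a b := by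
  refine concat_eq_of_sum fun s t => ?_
  obtain ⟨x, s, rfl⟩ := exists_cons s
  obtain ⟨y, t, rfl⟩ := exists_cons t
  rw [sum_bool_cons]
  have := colorMatrix_mul_eq a b s t
  rcases x <;> rcases y <;> simp [colorMatrix_addTop, this]

theorem concat_addTop_closeTop {m d e : ℕ} (a : Diagram m d) (b : Diagram d (e + 1)) :
    concat a.addTop b.closeTop = (concat a b).closeTop ∧
      loops a.addTop b.closeTop = loops a b := by
  refine concat_eq_of_sum fun s t => ?_
  obtain ⟨x, s, rfl⟩ := exists_cons s
  rw [sum_bool_cons]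
  have := colorMatrix_mul_eq a b s (Fin.cons x t)
  rcases x <;> simp [colorMatrix_addTop, colorMatrix_closeTop, this]

theorem concat_closeTop {m d e : ℕ} (a : Diagram m (d + 1)) (b : Diagram d e) :
    concat a.closeTop b = (concat a b.addTop).closeTop ∧
      loops a.closeTop b = loops a b.addTop := by
  refine concat_eq_of_sum fun s t => ?_
  obtain ⟨x, s, rfl⟩ := exists_cons s
  rw [colorMatrix_closeTop, ← colorMatrix_mul_eq, sum_bool_cons]
  rcases x <;> simp [colorMatrix_addTop, colorMatrix_closeTop]

theorem concat_reflect {m d e : ℕ} (a : Diagram m d) (b : Diagram d e) :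
    concat b.reflect a.reflect = (concat a b).reflect ∧
      loops b.reflect a.reflect = loops a b := by
  refine concat_eq_of_sum fun s t => ?_
  rw [colorMatrix_reflect, ← colorMatrix_mul_eq]
  simp only [colorMatrix_reflect, mul_comm]

theorem colorMatrix_id {n : ℕ} (s t : Fin n → Bool) :
    (Diagram.id n).colorMatrix s t = if s = t then 1 else 0 := by
  split_ifs with h
  · exact colorMatrix_eq_one ((compat_id s t).2 h)
  · exact colorMatrix_eq_zero (mt (compat_id s t).1 h)

theorem concat_id_left {m d : ℕ} (a : Diagram m d) :
    concat (Diagram.id m) a = a ∧ loops (Diagram.id m) a = 0 := by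
  refine concat_eq_of_sum fun s t => ?_
  simp [colorMatrix_id]

theorem concat_id_right {m d : ℕ} (a : Diagram m d) :
    concat a (Diagram.id d) = a ∧ loops a (Diagram.id d) = 0 := by
  refine concat_eq_of_sum fun s t => ?_
  simp [colorMatrix_id]

/-- Associativity of the matrix product; comparing the powers of 2 gives the equality of the loop
numbers. -/
theorem concat_assoc {m d e f : ℕ} (a : Diagram m d) (b : Diagram d e) (c : Diagram e f) :
    concat (concat a b) c = concat a (concat b c) ∧
      loops a b + loops (concat a b) c = loops b c + loops a (concat b c) := by
  apply pow_smul_colorMatrix_inj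
  rw [pow_add, mul_smul, ← colorMatrix_mul, ← Matrix.smul_mul, ← colorMatrix_mul,
    pow_add, mul_smul, ← colorMatrix_mul, ← Matrix.mul_smul, ← colorMatrix_mul, Matrix.mul_assoc]

theorem concat_reflect_closeTop_id (n : ℕ) :
    concat (Diagram.id (n + 1)).closeTop.reflect (Diagram.id (n + 1)).closeTop = Diagram.id n ∧
      loops (Diagram.id (n + 1)).closeTop.reflect (Diagram.id (n + 1)).closeTop = 1 := by
  refine concat_eq_of_sum fun s t => ?_
  rw [sum_bool_cons]
  simp [colorMatrix_reflect, colorMatrix_closeTop, colorMatrix_id, eq_comm]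

@[simp] theorem reflect_reflect {m d : ℕ} (D : Diagram m d) : D.reflect.reflect = D := by
  ext1
  funext x
  simp [reflect]

theorem reflect_injective {m d : ℕ} : Function.Injective (reflect (m := m) (d := d)) :=
  Function.LeftInverse.injective reflect_reflect

@[simp] theorem reflect_id (n : ℕ) : (Diagram.id n).reflect = Diagram.id n := by
  ext1
  funext x
  simp [reflect, Diagram.id]

theorem eq_of_compat_iff {m d : ℕ} {D D' : Diagram m d}
    (h : ∀ s t, D.Compat s t ↔ D'.Compat s t) : D = D' :=
  ext_of_compat fun s t => (h s t).1

theorem reflect_addTop {m d : ℕ} (D : Diagram m d) : D.addTop.reflect = D.reflect.addTop := by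
  refine eq_of_compat_iff fun s t => ?_
  rw [compat_reflect, compat_addTop, compat_addTop, compat_reflect, eq_comm]

theorem addTop_id (n : ℕ) : (Diagram.id n).addTop = Diagram.id (n + 1) := by
  refine eq_of_compat_iff fun s t => ?_
  rw [compat_addTop, compat_id, compat_id]
  constructor
  · rintro ⟨h0, h1⟩
    rw [← Fin.cons_self_tail s, ← Fin.cons_self_tail t, h0, h1]
  · rintro rfl
    exact ⟨rfl, rfl⟩

theorem closeTop_reflect_closeTop_id (n : ℕ) :
    (Diagram.id (n + 1)).closeTop.reflect.closeTop = Diagram.id (n + 1) := by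
  refine eq_of_compat_iff fun s t => ?_
  rw [compat_closeTop, compat_reflect, compat_closeTop, compat_id, compat_id]
  simp only [Fin.tail_cons, Fin.cons_zero, Fin.cons_self_tail, eq_comm]

theorem closeTop_injective {m d : ℕ} : Function.Injective (closeTop (m := m) (d := d)) := by
  intro D D' h
  refine eq_of_compat_iff fun s t => ?_
  have h1 := compat_closeTop D (Fin.cons (t 0) s) (Fin.tail t)
  have h2 := compat_closeTop D' (Fin.cons (t 0) s) (Fin.tail t)
  rw [h] at h1
  simp only [Fin.tail_cons, Fin.cons_zero, Fin.cons_self_tail] at h1 h2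
  rw [← h1, h2]

theorem addTop_injective {m d : ℕ} : Function.Injective (addTop (m := m) (d := d)) := by
  intro D D' h
  refine eq_of_compat_iff fun s t => ?_
  have h1 := compat_addTop D (Fin.cons false s) (Fin.cons false t)
  have h2 := compat_addTop D' (Fin.cons false s) (Fin.cons false t)
  rw [h] at h1
  simpa using h1.symm.trans h2

theorem gen_succ {n i : ℕ} (h : i + 1 + 1 < n + 1) :
    gen (i + 1) h = (gen i (n := n) (by omega)).addTop := by
  ext1
  funext x
  rcases shift_cases x with rfl | rfl | ⟨x | x, rfl⟩
  · simp [gen, genMate, addTop, Fin.ext_iff]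
  · simp [gen, genMate, addTop, Fin.ext_iff]
  · simp only [addTop, addTopMate_shift]
    simp only [gen, genMate, shift, Sum.map_inl, Fin.ext_iff, Fin.val_succ, add_left_inj]
    split_ifs <;> simp
  · simp only [addTop, addTopMate_shift]
    simp only [gen, genMate, shift, Sum.map_inr, Fin.ext_iff, Fin.val_succ, add_left_inj]
    split_ifs <;> simp

theorem gen_zero (n : ℕ) :
    gen (n := n + 2) 0 (by omega) =
      (Diagram.id (n + 1)).closeTop.reflect.addTop.closeTop := by
  ext1
  funext x
  obtain ⟨x, rfl⟩ := turn.surjective x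
  simp only [closeTop, Equiv.symm_apply_apply, addTop]
  rcases shift_cases x with rfl | rfl | ⟨x, rfl⟩
  · rfl
  · rfl
  · rw [addTopMate_shift]
    simp only [reflect]
    rcases x with x | x
    · rfl
    · refine Fin.cases ?_ (fun j => ?_) x
      · rfl
      · refine Fin.cases rfl (fun j => rfl) j
end Diagram

/-! ### Linear extension of the operations on diagrams -/

theorem single_apply {m d : ℕ} (D D' : Diagram m d) :
    single D D' = if D' = D then 1 else 0 := by
  simp [single, Pi.single_apply]

/-- The linear map that sends each diagram `D` to `f D`. -/
noncomputable def extend {m d : ℕ} {M : Type*} [AddCommGroup M] [Module ℂ M]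
    (f : Diagram m d → M) : Comb m d →ₗ[ℂ] M :=
  Fintype.linearCombination ℂ f

theorem extend_single {m d : ℕ} {M : Type*} [AddCommGroup M] [Module ℂ M]
    (f : Diagram m d → M) (D : Diagram m d) : extend f (single D) = f D := by
  simp [extend, single]

theorem sum_smul_single {m d : ℕ} (x : Comb m d) : ∑ D, x D • single D = x := by
  ext D
  simp [single_apply]

theorem hom_ext {m d : ℕ} {M : Type*} [AddCommGroup M] [Module ℂ M]
    {f g : Comb m d →ₗ[ℂ] M} (h : ∀ D, f (single D) = g (single D)) : f = g := by
  refine LinearMap.ext fun x => ?_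
  rw [← sum_smul_single x]
  simp [h]

/-- The linear extension of `Diagram.addTop`. -/
noncomputable def addTopL {m d : ℕ} : Comb m d →ₗ[ℂ] Comb (m + 1) (d + 1) :=
  extend fun a => single a.addTop

/-- `TemperleyLieb.closeTop` as a linear map. -/
noncomputable def closeTopL {m d : ℕ} : Comb m (d + 1) →ₗ[ℂ] Comb (m + 1) d :=
  extend fun a => single a.closeTop

/-- `TemperleyLieb.mirror` as a linear map. -/
noncomputable def mirrorL {m d : ℕ} : Comb m d →ₗ[ℂ] Comb d m :=
  extend fun a => single a.reflect

/-- `TemperleyLieb.comp` as a bilinear map. -/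
noncomputable def compL (β : ℂ) {m d e : ℕ} : Comb m d →ₗ[ℂ] Comb d e →ₗ[ℂ] Comb m e :=
  extend fun a => extend fun b => β ^ Diagram.loops a b • single (Diagram.concat a b)

theorem addTopL_single {m d : ℕ} (D : Diagram m d) :
    addTopL (single D) = single D.addTop := extend_single _ _

theorem closeTopL_single {m d : ℕ} (D : Diagram m (d + 1)) :
    closeTopL (single D) = single D.closeTop := extend_single _ _

theorem mirrorL_single {m d : ℕ} (D : Diagram m d) :
    mirrorL (single D) = single D.reflect := extend_single _ _

theorem compL_single (β : ℂ) {m d e : ℕ} (a : Diagram m d) (b : Diagram d e) :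
    compL β (single a) (single b) = β ^ Diagram.loops a b • single (Diagram.concat a b) := by
  rw [compL, extend_single, extend_single]

theorem closeTop_eq {m d : ℕ} (x : Comb m (d + 1)) : closeTop x = closeTopL x := rfl

theorem mirror_eq {m d : ℕ} (x : Comb m d) : mirror x = mirrorL x := by
  conv_rhs => rw [← sum_smul_single x]
  ext D
  simp only [map_sum, map_smul, mirrorL_single, Finset.sum_apply, Pi.smul_apply, single_apply,
    smul_eq_mul, mul_ite, mul_one, mul_zero, mirror]
  rw [Finset.sum_eq_single D.reflect]
  · simp
  · intro b _ hb
    rw [if_neg]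
    rintro rfl
    simp at hb
  · simp

theorem comp_eq (β : ℂ) {m d e : ℕ} (x : Comb m d) (y : Comb d e) : comp β x y = compL β x y := by
  classical
  ext c
  conv_rhs => rw [← sum_smul_single x, ← sum_smul_single y]
  simp only [map_sum, map_smul, LinearMap.sum_apply, LinearMap.smul_apply, compL_single,
    Finset.sum_apply, Pi.smul_apply, single_apply, smul_eq_mul, comp, Diagram.isConcat_iff]
  rw [Finset.sum_comm]
  refine Finset.sum_congr rfl fun b _ => ?_
  rw [Finset.mul_sum]
  refine Finset.sum_congr rfl fun a _ => ?_
  by_cases h : Diagram.concat a b = c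
  · simp [h]; ring
  · simp [h, Ne.symm h]

theorem compL_apply (β : ℂ) {m d e : ℕ} (x : Comb m d) (y : Comb d e) (c : Diagram m e) :
    compL β x y c = ∑ a, ∑ b, x a * y b * β ^ Diagram.loops a b *
      (if c = Diagram.concat a b then 1 else 0) := by
  classical
  rw [← comp_eq, comp]
  refine Finset.sum_congr rfl fun a _ => Finset.sum_congr rfl fun b _ => ?_
  by_cases h : Diagram.concat a b = c
  · simp [h, Diagram.isConcat_iff]; ring
  · simp [h, Ne.symm h, Diagram.isConcat_iff]

theorem comb_induction {m d : ℕ} {p : Comb m d → Prop} (x : Comb m d)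
    (hadd : ∀ x y, p x → p y → p (x + y)) (hsmul : ∀ (c : ℂ) x, p x → p (c • x))
    (hsingle : ∀ D, p (single D)) (hzero : p 0) : p x := by
  rw [← sum_smul_single x]
  exact Finset.sum_induction _ p hadd hzero fun D _ => hsmul _ _ (hsingle D)

theorem compL_assoc (β : ℂ) {m d e f : ℕ} (x : Comb m d) (y : Comb d e) (z : Comb e f) :
    compL β (compL β x y) z = compL β x (compL β y z) := by
  induction x using comb_induction with
  | hadd x y hx hy => simp [hx, hy]
  | hsmul c x hx => simp [hx]
  | hzero => simp
  | hsingle a =>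
    induction y using comb_induction with
    | hadd x y hx hy => simp [hx, hy]
    | hsmul c x hx => simp [hx]
    | hzero => simp
    | hsingle b =>
      induction z using comb_induction with
      | hadd x y hx hy => simp [hx, hy]
      | hsmul c x hx => simp [hx]
      | hzero => simp
      | hsingle c =>
        obtain ⟨h1, h2⟩ := Diagram.concat_assoc a b c
        simp only [compL_single, map_smul, LinearMap.smul_apply, smul_smul, ← pow_add, h1, h2]

/-- An identity between bilinear maps follows from its instances for diagrams. -/
theorem hom_ext₂ {m d m' d' : ℕ} {M : Type*} [AddCommGroup M] [Module ℂ M]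
    {f g : Comb m d →ₗ[ℂ] Comb m' d' →ₗ[ℂ] M}
    (h : ∀ D D', f (single D) (single D') = g (single D) (single D')) : f = g :=
  hom_ext fun D => hom_ext fun D' => h D D'

theorem compL_addTopL (β : ℂ) {m d e : ℕ} (x : Comb m d) (y : Comb d e) :
    compL β (addTopL x) (addTopL y) = addTopL (compL β x y) := by
  have : (compL β).compl₁₂ addTopL addTopL = ((compL β).compr₂ addTopL :
      Comb m d →ₗ[ℂ] Comb d e →ₗ[ℂ] _) := hom_ext₂ fun a b => by
    simp [addTopL_single, compL_single, Diagram.concat_addTop]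
  exact LinearMap.congr_fun₂ this x y

theorem compL_addTopL_closeTopL (β : ℂ) {m d e : ℕ} (x : Comb m d) (y : Comb d (e + 1)) :
    compL β (addTopL x) (closeTopL y) = closeTopL (compL β x y) := by
  have : (compL β).compl₁₂ addTopL closeTopL = ((compL β).compr₂ closeTopL :
      Comb m d →ₗ[ℂ] Comb d (e + 1) →ₗ[ℂ] _) := hom_ext₂ fun a b => by
    simp [addTopL_single, closeTopL_single, compL_single, Diagram.concat_addTop_closeTop]
  exact LinearMap.congr_fun₂ this x y

theorem compL_closeTopL (β : ℂ) {m d e : ℕ} (x : Comb m (d + 1)) (y : Comb d e) :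
    compL β (closeTopL x) y = closeTopL (compL β x (addTopL y)) := by
  have : (compL β).compl₁₂ closeTopL LinearMap.id =
      (((compL β).compl₁₂ LinearMap.id addTopL).compr₂ closeTopL :
      Comb m (d + 1) →ₗ[ℂ] Comb d e →ₗ[ℂ] _) := hom_ext₂ fun a b => by
    simp [addTopL_single, closeTopL_single, compL_single, Diagram.concat_closeTop]
  exact LinearMap.congr_fun₂ this x y

theorem mirrorL_compL (β : ℂ) {m d e : ℕ} (x : Comb m d) (y : Comb d e) :
    mirrorL (compL β x y) = compL β (mirrorL y) (mirrorL x) := by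
  have : ((compL β).compl₁₂ mirrorL mirrorL).flip = ((compL β).compr₂ mirrorL :
      Comb m d →ₗ[ℂ] Comb d e →ₗ[ℂ] _) := hom_ext₂ fun a b => by
    simp [mirrorL_single, compL_single, Diagram.concat_reflect]
  exact (LinearMap.congr_fun₂ this x y).symm

theorem mirrorL_addTopL {m d : ℕ} (x : Comb m d) :
    mirrorL (addTopL x) = addTopL (mirrorL x) := by
  have : mirrorL ∘ₗ addTopL = (addTopL ∘ₗ mirrorL : Comb m d →ₗ[ℂ] _) := hom_ext fun a => by
    simp [mirrorL_single, addTopL_single, Diagram.reflect_addTop]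
  exact LinearMap.congr_fun this x

theorem mirrorL_mirrorL {m d : ℕ} (x : Comb m d) : mirrorL (mirrorL x) = x := by
  have : mirrorL ∘ₗ mirrorL = (LinearMap.id : Comb m d →ₗ[ℂ] _) := hom_ext fun a => by
    simp [mirrorL_single]
  exact LinearMap.congr_fun this x

theorem mirrorL_apply {m d : ℕ} (x : Comb m d) (D : Diagram d m) :
    mirrorL x D = x D.reflect := by
  rw [← mirror_eq, mirror]

theorem compL_id_left (β : ℂ) {m d : ℕ} (x : Comb m d) :
    compL β (single (Diagram.id m)) x = x := by
  have : compL β (single (Diagram.id m)) = (LinearMap.id : Comb m d →ₗ[ℂ] _) :=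
    hom_ext fun a => by simp [compL_single, Diagram.concat_id_left]
  exact LinearMap.congr_fun this x

theorem compL_id_right (β : ℂ) {m d : ℕ} (x : Comb m d) :
    compL β x (single (Diagram.id d)) = x := by
  have : (compL β).flip (single (Diagram.id d)) = (LinearMap.id : Comb m d →ₗ[ℂ] _) :=
    hom_ext fun a => by simp [compL_single, Diagram.concat_id_right]
  exact LinearMap.congr_fun this x

theorem closeTopL_apply {m d : ℕ} (x : Comb m (d + 1)) (D : Diagram m (d + 1)) :
    closeTopL x D.closeTop = x D := by
  conv_lhs => rw [← sum_smul_single x]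
  simp [closeTopL_single, single_apply, Diagram.closeTop_injective.eq_iff]

theorem addTopL_apply {m d : ℕ} (x : Comb m d) (D : Diagram m d) :
    addTopL x D.addTop = x D := by
  conv_lhs => rw [← sum_smul_single x]
  simp [addTopL_single, single_apply, Diagram.addTop_injective.eq_iff]

/-! ### Monic diagrams and caps -/

namespace Diagram

/-- Bending is a cyclic rotation of the boundary points. It can be undone, and being free of
crossings is invariant under rotation. -/
theorem exists_closeTop_eq {m d : ℕ} (D : Diagram (m + 1) d) :
    ∃ D' : Diagram m (d + 1), D'.closeTop = D := by
  let D' : Diagram m (d + 1) :=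
    { mate := fun x => turn.symm (D.mate (turn x))
      mate_mate := fun x => by simp [D.mate_mate]
      mate_ne := fun x h => D.mate_ne (turn x) (by rw [Equiv.symm_apply_eq] at h; exact h)
      noncrossing := fun x y => by
        have a1 := pos_turn x
        have a2 := pos_turn y
        have a3 := pos_turn (turn.symm (D.mate (turn x)))
        have a4 := pos_turn (turn.symm (D.mate (turn y)))
        rw [Equiv.apply_symm_apply] at a3 a4
        have h1 := D.noncrossing (turn x) (turn y)
        have h2 := D.noncrossing (D.mate (turn y)) (turn x)
        rw [D.mate_mate] at h2
        omega }
  refine ⟨D', ?_⟩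
  ext1
  funext x
  simp [D', closeTop]

theorem exists_addTop_eq {m d : ℕ} (D : Diagram (m + 1) (d + 1))
    (h : D.mate (Sum.inl 0) = Sum.inr 0) : ∃ D' : Diagram m d, D'.addTop = D := by
  refine ⟨D.ptr, ?_⟩
  have h' : D.mate (Sum.inr 0) = Sum.inl 0 := by rw [← h, D.mate_mate]
  ext1
  funext x
  rcases shift_cases x with rfl | rfl | ⟨x, rfl⟩
  · simp [addTop, h]
  · simp [addTop, h']
  · simp only [addTop, addTopMate_shift, shift_ptr_mate]
    rcases D.hop_cases (shift x) with ⟨a, b, c⟩ | ⟨a, b, c⟩ | ⟨a, b, c⟩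
    · exact absurd (b.symm.trans h) (shift_ne_inr_zero x)
    · exact absurd (b.symm.trans h') (shift_ne_inl_zero x)
    · exact c

theorem isMonic_id (n : ℕ) : (Diagram.id n).IsMonic := fun j => ⟨j, rfl⟩

theorem isMonic_addTop {m d : ℕ} (D : Diagram m d) : D.addTop.IsMonic ↔ D.IsMonic := by
  constructor
  · intro h j
    obtain ⟨i, hi⟩ := h j.succ
    have : D.addTop.mate (Sum.inr j.succ) = shift (D.mate (Sum.inr j)) := rfl
    rw [this] at hi
    rcases h' : D.mate (Sum.inr j) with y | y
    · exact ⟨y, rfl⟩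
    · rw [h'] at hi; simp [shift] at hi
  · intro h j
    refine Fin.cases ⟨0, rfl⟩ (fun j => ?_) j
    obtain ⟨i, hi⟩ := h j
    refine ⟨i.succ, ?_⟩
    have : D.addTop.mate (Sum.inr j.succ) = shift (D.mate (Sum.inr j)) := rfl
    rw [this, hi]
    rfl

theorem isMonic_closeTop {m d : ℕ} {D : Diagram m (d + 1)} (h : D.IsMonic) :
    D.closeTop.IsMonic := by
  intro j
  obtain ⟨i, hi⟩ := h j.succ
  refine ⟨i.succ, ?_⟩
  change turn (D.mate (turn.symm (Sum.inr j))) = _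
  have : (turn.symm (Sum.inr j) : Fin m ⊕ Fin (d + 1)) = Sum.inr j.succ := rfl
  rw [this, hi]
  rfl

theorem isMonic_le {m d : ℕ} {D : Diagram m d} (h : D.IsMonic) : d ≤ m := by
  choose f hf using h
  have : Function.Injective f := by
    intro j j' hj
    have h1 := D.mate_mate (Sum.inr j)
    have h2 := D.mate_mate (Sum.inr j')
    rw [hf, hj, ← hf, D.mate_mate] at h1
    exact (Sum.inr_injective h1).symm
  simpa using Fintype.card_le_of_injective f this

/-- A monic diagram either has a through line at the top, or its top left point is joined to
another left point. -/
theorem IsMonic.cases {m d : ℕ} {D : Diagram (m + 1) d} (h : D.IsMonic) :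
    (∃ (d' : ℕ) (hd : d = d' + 1) (D' : Diagram m d'), D'.IsMonic ∧ hd ▸ D = D'.addTop) ∨
      ∃ D' : Diagram m (d + 1), D'.IsMonic ∧ D = D'.closeTop := by
  rcases h0 : D.mate (Sum.inl 0) with i | j
  · right
    obtain ⟨D', rfl⟩ := exists_closeTop_eq D
    refine ⟨D', fun j => ?_, rfl⟩
    have h0' : D'.closeTop.mate (Sum.inl 0) = turn (D'.mate (Sum.inr 0)) := rfl
    refine Fin.cases ?_ (fun j => ?_) j
    · rw [h0'] at h0
      rcases hx : D'.mate (Sum.inr 0) with y | y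
      · exact ⟨y, rfl⟩
      · rw [hx] at h0
        revert hx h0
        refine Fin.cases (fun _ hx => absurd hx (D'.mate_ne _)) (fun y h0 _ => ?_) y
        change Sum.inr y = Sum.inl i at h0
        simp at h0
    · obtain ⟨i', hi'⟩ := h j
      have hj : D'.closeTop.mate (Sum.inr j) = turn (D'.mate (Sum.inr j.succ)) := rfl
      rw [hj] at hi'
      rcases hx : D'.mate (Sum.inr j.succ) with y | y
      · exact ⟨y, rfl⟩
      · rw [hx] at hi'
        revert hx hi'
        refine Fin.cases (fun _ hx => ?_) (fun y h0 _ => ?_) y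
        · have := D'.mate_mate (Sum.inr j.succ)
          rw [hx] at this
          rw [h0', this] at h0
          change Sum.inr j = Sum.inl i at h0
          simp at h0
        · change Sum.inr y = Sum.inl i' at h0
          simp at h0
  · left
    obtain ⟨d, rfl⟩ : ∃ d', d = d' + 1 := ⟨d - 1, by have := j.2; omega⟩
    -- Otherwise the link at the topmost right point, which ends on the left by monicity, would
    -- cross the link at the top left point.
    have hj : j = 0 := by
      by_contra hne
      obtain ⟨i, hi⟩ := h 0
      have h1 := D.noncrossing (Sum.inl 0) (Sum.inl i)
      have h2 : D.mate (Sum.inl i) = Sum.inr 0 := by rw [← hi, D.mate_mate]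
      rw [h0, h2] at h1
      simp only [pos, Fin.val_zero] at h1
      have hi0 : (i : ℕ) ≠ 0 := by
        intro hc
        have : i = 0 := Fin.ext hc
        rw [this, h0] at h2
        exact hne (Sum.inr_injective h2)
      have : (j : ℕ) ≠ 0 := fun hc => hne (Fin.ext hc)
      omega
    subst hj
    obtain ⟨D', rfl⟩ := exists_addTop_eq D h0
    exact ⟨d, rfl, D', (isMonic_addTop _).1 h, rfl⟩

theorem IsMonic.eq_id {n : ℕ} {D : Diagram n n} (h : D.IsMonic) : D = Diagram.id n := by
  induction n with
  | zero =>
    ext1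
    funext x
    rcases x with x | x <;> exact x.elim0
  | succ n ih =>
    rcases h.cases with ⟨d', hd, D', hD', he⟩ | ⟨D', hD', he⟩
    · obtain rfl : n = d' := by omega
      change D = _ at he
      rw [he, ih hD', addTop_id]
    -- Undoing the bend would leave a monic diagram with more right points than left points.
    · have := isMonic_le hD'
      omega

/-- The monic diagram with `D + 2` left points and `D` right points whose only left link joins
the points `i` and `i + 1`, for `i ≤ D`. -/
noncomputable def cap : (D : ℕ) → ℕ → Diagram (D + 2) D
  | D, 0 => (Diagram.id (D + 1)).closeTop
  | 0, _ + 1 => (Diagram.id 1).closeTop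
  | D + 1, i + 1 => (cap D i).addTop

theorem cap_zero (D : ℕ) : cap D 0 = (Diagram.id (D + 1)).closeTop := by
  cases D <;> rfl

theorem cap_succ (D i : ℕ) : cap (D + 1) (i + 1) = (cap D i).addTop := rfl

theorem isMonic_cap (D i : ℕ) : (cap D i).IsMonic := by
  induction D generalizing i with
  | zero =>
    intro j
    exact j.elim0
  | succ D ih =>
    cases i with
    | zero => rw [cap_zero]; exact isMonic_closeTop (isMonic_id _)
    | succ i => rw [cap_succ, isMonic_addTop]; exact ih i

theorem IsMonic.eq_cap {n : ℕ} {D : Diagram (n + 2) n} (h : D.IsMonic) :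
    ∃ i ≤ n, D = cap n i := by
  induction n with
  | zero =>
    rcases h.cases with ⟨d', hd, D', hD', he⟩ | ⟨D', hD', he⟩
    · omega
    · exact ⟨0, le_rfl, by rw [he, hD'.eq_id, cap_zero]⟩
  | succ n ih =>
    rcases h.cases with ⟨d', hd, D', hD', he⟩ | ⟨D', hD', he⟩
    · obtain rfl : n = d' := by omega
      change D = _ at he
      obtain ⟨i, hi, hi'⟩ := ih hD'
      exact ⟨i + 1, by omega, by rw [he, hi', cap_succ]⟩
    · exact ⟨0, by omega, by rw [he, hD'.eq_id, cap_zero]⟩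

theorem cap_succ_ne_cap_zero (D i : ℕ) : cap (D + 1) (i + 1) ≠ cap (D + 1) 0 := by
  intro h
  have h1 : (cap (D + 1) (i + 1)).mate (Sum.inl 0) = Sum.inr 0 := rfl
  have h2 : (cap (D + 1) 0).mate (Sum.inl 0) = Sum.inl 1 := by
    rw [cap_zero]; rfl
  rw [h, h2] at h1
  simp at h1

theorem cap_injOn (D : ℕ) : ∀ i ≤ D, ∀ j ≤ D, cap D i = cap D j → i = j := by
  induction D with
  | zero => intro i hi j hj _; omega
  | succ D ih =>
    rintro (_ | i) hi (_ | j) hj h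
    · rfl
    · exact absurd h.symm (cap_succ_ne_cap_zero D j)
    · exact absurd h (cap_succ_ne_cap_zero D i)
    · rw [cap_succ, cap_succ, addTop_injective.eq_iff] at h
      rw [ih i (by omega) j (by omega) h]

theorem cap_loop (D i : ℕ) :
    concat (cap D i).reflect (cap D i) = Diagram.id D ∧
      loops (cap D i).reflect (cap D i) = 1 := by
  induction D generalizing i with
  | zero => cases i <;> exact concat_reflect_closeTop_id 0
  | succ D ih =>
    cases i with
    | zero => rw [cap_zero]; exact concat_reflect_closeTop_id _
    | succ i =>
      rw [cap_succ, reflect_addTop, (concat_addTop _ _).1, (concat_addTop _ _).2, (ih i).1,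
        (ih i).2, addTop_id]
      exact ⟨rfl, rfl⟩

theorem concat_cap_succ_cap_zero (D i : ℕ) :
    concat (cap (D + 1) (i + 1)).reflect (cap (D + 1) 0) = (cap D i).reflect.closeTop ∧
      loops (cap (D + 1) (i + 1)).reflect (cap (D + 1) 0) = 0 := by
  rw [cap_succ, cap_zero, reflect_addTop, (concat_addTop_closeTop _ _).1,
    (concat_addTop_closeTop _ _).2, (concat_id_right _).1, (concat_id_right _).2]
  exact ⟨rfl, rfl⟩

/-- Two neighbouring arcs form a zigzag, which straightens to a line without creating a loop. -/
theorem cap_snake (D i : ℕ) (hi : i < D) :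
    concat (cap D (i + 1)).reflect (cap D i) = Diagram.id D ∧
      loops (cap D (i + 1)).reflect (cap D i) = 0 := by
  induction D generalizing i with
  | zero => omega
  | succ D ih =>
    cases i with
    | zero =>
      have := concat_cap_succ_cap_zero D 0
      rwa [cap_zero D, closeTop_reflect_closeTop_id] at this
    | succ i =>
      rw [cap_succ, cap_succ, reflect_addTop, (concat_addTop _ _).1, (concat_addTop _ _).2,
        (ih i (by omega)).1, (ih i (by omega)).2, addTop_id]
      exact ⟨rfl, rfl⟩

theorem cap_snake' (D i : ℕ) (hi : i < D) :
    concat (cap D i).reflect (cap D (i + 1)) = Diagram.id D ∧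
      loops (cap D i).reflect (cap D (i + 1)) = 0 := by
  have := concat_reflect (cap D (i + 1)).reflect (cap D i)
  rw [(cap_snake D i hi).1, (cap_snake D i hi).2, reflect_reflect, reflect_id] at this
  exact this

/-- Common through lines at the top are removed until `i = 0`. There the concatenation is a bent
reflected cap, and if it were the identity two caps with different indices would coincide. -/
theorem cap_far (D i j : ℕ) (hj : j ≤ D) (hij : i + 2 ≤ j) :
    concat (cap D j).reflect (cap D i) ≠ Diagram.id D := by
  induction D generalizing i j with
  | zero => omega
  | succ D ih =>
    obtain ⟨j, rfl⟩ : ∃ j', j = j' + 1 := ⟨j - 1, by omega⟩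
    cases i with
    | zero =>
      rw [(concat_cap_succ_cap_zero D j).1, ← closeTop_reflect_closeTop_id D,
        closeTop_injective.ne_iff, reflect_injective.ne_iff, ← cap_zero]
      intro h
      have := cap_injOn D j (by omega) 0 (by omega) h
      omega
    | succ i =>
      rw [cap_succ, cap_succ, reflect_addTop, (concat_addTop _ _).1, ← addTop_id,
        addTop_injective.ne_iff]
      exact ih i j (by omega) (by omega)

theorem cap_far' (D i j : ℕ) (hj : j ≤ D) (hij : i + 2 ≤ j) :
    concat (cap D i).reflect (cap D j) ≠ Diagram.id D := by
  have := (concat_reflect (cap D j).reflect (cap D i)).1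
  rw [reflect_reflect] at this
  rw [this, ← reflect_id, reflect_injective.ne_iff]
  exact cap_far D i j hj hij

/-- This factorisation of the generators reduces their square and adjacency relations to the
pairings of caps. -/
theorem concat_cap_reflect (D i : ℕ) (hi : i ≤ D) :
    concat (cap D i) (cap D i).reflect = gen (n := D + 2) i (by omega) ∧
      loops (cap D i) (cap D i).reflect = 0 := by
  have hzero : ∀ D, concat (cap D 0) (cap D 0).reflect = gen (n := D + 2) 0 (by omega) ∧
      loops (cap D 0) (cap D 0).reflect = 0 := by
    intro D
    rw [cap_zero, (concat_closeTop _ _).1, (concat_closeTop _ _).2, (concat_id_left _).1,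
      (concat_id_left _).2, gen_zero]
    exact ⟨rfl, rfl⟩
  induction D generalizing i with
  | zero =>
    obtain rfl : i = 0 := by omega
    exact hzero 0
  | succ D ih =>
    cases i with
    | zero => exact hzero _
    | succ i =>
      have := ih i (by omega) hzero
      rw [cap_succ, reflect_addTop, (concat_addTop _ _).1, (concat_addTop _ _).2, this.1, this.2,
        gen_succ]
      exact ⟨rfl, rfl⟩

theorem isMonic_concat {m d e : ℕ} {a : Diagram m d} {b : Diagram d e} (ha : a.IsMonic)
    (hb : b.IsMonic) : (concat a b).IsMonic := by
  intro j
  obtain ⟨i, hi⟩ := hb j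
  obtain ⟨i', hi'⟩ := ha i
  refine ⟨i', mate_eq_of_compat (by simp) fun s t hst => ?_⟩
  obtain ⟨u, h1, h2⟩ := (compat_concat a b s t).1 hst
  have e1 := h1 (Sum.inr i)
  have e2 := h2 (Sum.inr j)
  rw [hi'] at e1
  rw [hi] at e2
  exact e2.symm.trans e1.symm

/-- A link between two right points of `b` survives in the concatenation. -/
theorem isMonic_of_concat {m d e : ℕ} {a : Diagram m d} {b : Diagram d e}
    (h : (concat a b).IsMonic) : b.IsMonic := by
  intro j
  rcases hj : b.mate (Sum.inr j) with i | j'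
  · exact ⟨i, rfl⟩
  · exfalso
    obtain ⟨i, hi⟩ := h j
    have : (concat a b).mate (Sum.inr j) = Sum.inr j' := by
      refine mate_eq_of_compat (fun hc => b.mate_ne (Sum.inr j) (by rw [hj, Sum.inr_injective hc]))
        fun s t hst => ?_
      obtain ⟨u, h1, h2⟩ := (compat_concat a b s t).1 hst
      have e2 := h2 (Sum.inr j)
      rw [hj] at e2
      exact e2.symm
    rw [hi] at this
    simp at this

end Diagram

/-! ### Quantum integers and Wenzl–Jones projectors in an abstract algebra -/

theorem qnum_zero (q : ℂ) : qnum q 0 = 0 := by simp [qnum]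

theorem qnum_one {q : ℂ} (h : q - q⁻¹ ≠ 0) : qnum q 1 = 1 := by simp [qnum, div_self h]

theorem qnum_add_two {q : ℂ} (hq : q ≠ 0) (m : ℕ) :
    qnum q (m + 2) = (q + q⁻¹) * qnum q (m + 1) - qnum q m := by
  unfold qnum
  rw [← mul_div_assoc, ← sub_div]
  congr 1
  have h : q * q⁻¹ = 1 := mul_inv_cancel₀ hq
  linear_combination (-(q ^ m - q⁻¹ ^ m)) * h

theorem qnum_two {q : ℂ} (hq : q ≠ 0) (h : q - q⁻¹ ≠ 0) : qnum q 2 = q + q⁻¹ := by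
  rw [qnum_add_two hq, qnum_zero, qnum_one h]; ring

theorem qnum_ne_zero {q : ℂ} (hq : q ≠ 0) (h : q - q⁻¹ ≠ 0) {j : ℕ} (hj : q ^ (2 * j) ≠ 1) :
    qnum q j ≠ 0 := by
  unfold qnum
  refine div_ne_zero (fun hc => hj ?_) h
  have : q ^ j = q⁻¹ ^ j := sub_eq_zero.1 hc
  rw [two_mul, pow_add]
  nth_rewrite 1 [this]
  rw [← mul_pow, inv_mul_cancel₀ hq, one_pow]

section JonesWenzl

variable {R : Type*} [Ring R] [Algebra ℂ R] {q : ℂ} {e p : ℕ → R} {M : ℕ}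

/-- Only generators with index at most `k - 2` occur in `p k`, and all of them are far from `e j`.
-/
theorem jonesWenzl_commute (hfar : ∀ i j, i + 2 ≤ j → j < M → e i * e j = e j * e i)
    (p0 : p 0 = 1) (p1 : p 1 = 1)
    (hp : ∀ k, p (k + 2) = p (k + 1) - (qnum q (k + 1) / qnum q (k + 2)) •
      (p (k + 1) * e k * p (k + 1))) (k j : ℕ) (hkj : k ≤ j) (hj : j < M) :
    Commute (p k) (e j) := by
  induction k using Nat.strong_induction_on with
  | _ k ih =>
    match k with
    | 0 => rw [p0]; exact Commute.one_left _
    | 1 => rw [p1]; exact Commute.one_left _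
    | k + 2 =>
      have h1 := ih (k + 1) (by omega) (by omega)
      have h2 : Commute (e k) (e j) := hfar k j (by omega) hj
      rw [hp]
      exact h1.sub_left (((h1.mul_left h2).mul_left h1).smul_left _)

/-- The Wenzl–Jones projectors are idempotents that annihilate the generators. -/
theorem jonesWenzl (hq : q ≠ 0) (hq' : q - q⁻¹ ≠ 0)
    (hsq : ∀ i < M, e i * e i = (q + q⁻¹) • e i)
    (hadj : ∀ i, i + 1 < M → e (i + 1) * e i * e (i + 1) = e (i + 1))
    (hfar : ∀ i j, i + 2 ≤ j → j < M → e i * e j = e j * e i)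
    (p0 : p 0 = 1) (p1 : p 1 = 1)
    (hp : ∀ k, p (k + 2) = p (k + 1) - (qnum q (k + 1) / qnum q (k + 2)) •
      (p (k + 1) * e k * p (k + 1)))
    {K : ℕ} (hK : K ≤ M + 1) (hqn : ∀ j, 1 ≤ j → j ≤ K → qnum q j ≠ 0) (k : ℕ) (hk : k ≤ K) :
    p k * p k = p k ∧ ∀ j, j + 2 ≤ k → e j * p k = 0 ∧ p k * e j = 0 := by
  have hcomm := jonesWenzl_commute hfar p0 p1 hp
  induction k using Nat.strong_induction_on with
  | _ k ih =>
    match k with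
    | 0 => exact ⟨by rw [p0, one_mul], fun j hj => by omega⟩
    | 1 => exact ⟨by rw [p1, one_mul], fun j hj => by omega⟩
    | m + 2 =>
      obtain ⟨hidem, hann⟩ := ih (m + 1) (by omega) (by omega)
      obtain ⟨hidem0, -⟩ := ih m (by omega) (by omega)
      have hmM : m < M := by omega
      have hc : Commute (p m) (e m) := hcomm m m le_rfl hmM
      have habs : p m * p (m + 1) = p (m + 1) ∧ p (m + 1) * p m = p (m + 1) := by
        match m with
        | 0 => rw [p0]; simp
        | m + 1 =>
          rw [hp]
          constructor
          · rw [mul_sub, mul_smul_comm, ← mul_assoc, ← mul_assoc, hidem0]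
          · rw [sub_mul, smul_mul_assoc, mul_assoc (_ * _), hidem0]
      have hn1 : qnum q (m + 1) ≠ 0 := hqn _ (by omega) (by omega)
      have hn2 : qnum q (m + 2) ≠ 0 := hqn _ (by omega) (by omega)
      -- The coefficient is `β - [m] / [m + 1]`. It is inverse to the coefficient in the recursion
      -- for `p (m + 2)`, which is why the two terms of that recursion cancel against `e m`.
      have htr : e m * p (m + 1) * e m = (qnum q (m + 2) / qnum q (m + 1)) • (p m * e m) := by
        match m with
        | 0 =>
          rw [p1, p0, mul_one, one_mul, hsq 0 hmM, qnum_two hq hq', qnum_one hq', div_one]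
        | m + 1 =>
          have h1 : e (m + 1) * (p (m + 1) * e m * p (m + 1)) * e (m + 1) =
              p (m + 1) * e (m + 1) := by
            calc e (m + 1) * (p (m + 1) * e m * p (m + 1)) * e (m + 1)
                = (e (m + 1) * p (m + 1)) * e m * (p (m + 1) * e (m + 1)) := by
                  simp only [mul_assoc]
              _ = p (m + 1) * (e (m + 1) * e m * e (m + 1)) * p (m + 1) := by
                  rw [hc.eq]
                  nth_rewrite 1 [← hc.eq]
                  simp only [mul_assoc]
              _ = p (m + 1) * e (m + 1) := by
                  rw [hadj m hmM, mul_assoc, ← hc.eq, ← mul_assoc, hidem0]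
          have h2 : e (m + 1) * p (m + 1) * e (m + 1) = (q + q⁻¹) • (p (m + 1) * e (m + 1)) := by
            rw [← hc.eq, mul_assoc, hsq _ hmM, mul_smul_comm]
          rw [hp, mul_sub, sub_mul, mul_smul_comm, smul_mul_assoc, h1, h2, ← sub_smul]
          congr 1
          rw [qnum_add_two hq (m + 1)]
          field_simp
      have hscal : (qnum q (m + 1) / qnum q (m + 2)) * (qnum q (m + 2) / qnum q (m + 1)) = 1 := by
        field_simp
      have hann' : ∀ j, j + 2 ≤ m + 2 → e j * p (m + 2) = 0 ∧ p (m + 2) * e j = 0 := by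
        intro j hj
        rcases Nat.lt_or_ge j m with hlt | hge
        · obtain ⟨h1, h2⟩ := hann j (by omega)
          rw [hp]
          constructor
          · rw [mul_sub, mul_smul_comm, ← mul_assoc, ← mul_assoc, h1]; simp
          · rw [sub_mul, smul_mul_assoc, mul_assoc, h2]; simp
        · obtain rfl : j = m := by omega
          rw [hp]
          constructor
          · have : e j * (p (j + 1) * e j * p (j + 1)) =
                (e j * p (j + 1) * e j) * p (j + 1) := by simp only [mul_assoc]
            rw [mul_sub, mul_smul_comm, this, htr, smul_mul_assoc, smul_smul, hscal, one_smul,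
              hc.eq, mul_assoc, habs.1, sub_self]
          · have : p (j + 1) * e j * p (j + 1) * e j =
                p (j + 1) * (e j * p (j + 1) * e j) := by simp only [mul_assoc]
            rw [sub_mul, smul_mul_assoc, this, htr, mul_smul_comm, smul_smul, hscal, one_smul,
              ← mul_assoc, habs.2, sub_self]
      refine ⟨?_, hann'⟩
      have h1 : p (m + 2) * p (m + 1) = p (m + 2) := by
        rw [hp, sub_mul, smul_mul_assoc, mul_assoc (_ * _), hidem]
      have h2 := (hann' m le_rfl).2
      calc p (m + 2) * p (m + 2)
          = p (m + 2) * p (m + 1) - (qnum q (m + 1) / qnum q (m + 2)) •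
              (p (m + 2) * p (m + 1) * e m * p (m + 1)) := by
            conv_lhs => rhs; rw [hp]
            rw [mul_sub, mul_smul_comm]
            simp only [mul_assoc]
        _ = p (m + 2) := by rw [h1, h2]; simp

end JonesWenzl

/-! ### Temperley–Lieb relations and annihilation by the projectors -/

open Diagram

theorem E_eq {D i : ℕ} (hi : i ≤ D) (β : ℂ) :
    E (D + 2) i = compL β (single (cap D i)) (single (cap D i).reflect) := by
  rw [compL_single, (concat_cap_reflect D i hi).1, (concat_cap_reflect D i hi).2, E,
    dif_pos (by omega)]
  simp

theorem E_of_le {n i : ℕ} (h : n ≤ i + 1) : E n i = 0 := by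
  rw [E, dif_neg (by omega)]

theorem E_succ (n i : ℕ) : E (n + 1) (i + 1) = addTopL (E n i) := by
  by_cases h : i + 1 < n
  · rw [E, dif_pos (by omega), E, dif_pos h, addTopL_single, gen_succ]
  · rw [E_of_le (by omega), E_of_le (by omega), map_zero]

theorem compL_cap_self (β : ℂ) (D i : ℕ) :
    compL β (single (cap D i).reflect) (single (cap D i)) = β • single (Diagram.id D) := by
  rw [compL_single, (cap_loop D i).1, (cap_loop D i).2, pow_one]

theorem compL_E_self (β : ℂ) (n i : ℕ) : compL β (E n i) (E n i) = β • E n i := by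
  by_cases h : i + 1 < n
  · obtain ⟨D, rfl⟩ : ∃ D, n = D + 2 := ⟨n - 2, by omega⟩
    rw [E_eq (by omega) β, compL_assoc, ← compL_assoc β (single (cap D i).reflect),
      compL_cap_self, map_smul, LinearMap.smul_apply, compL_id_left, map_smul]
  · rw [E_of_le (by omega)]; simp

theorem compL_E_adjacent (β : ℂ) {n i : ℕ} (h : i + 2 < n) :
    compL β (compL β (E n i) (E n (i + 1))) (E n i) = E n i := by
  obtain ⟨D, rfl⟩ : ∃ D, n = D + 2 := ⟨n - 2, by omega⟩
  have h1 : compL β (single (cap D i).reflect) (single (cap D (i + 1))) =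
      single (Diagram.id D) := by
    rw [compL_single, (cap_snake' D i (by omega)).1, (cap_snake' D i (by omega)).2]; simp
  have h2 : compL β (single (cap D (i + 1)).reflect) (single (cap D i)) =
      single (Diagram.id D) := by
    rw [compL_single, (cap_snake D i (by omega)).1, (cap_snake D i (by omega)).2]; simp
  rw [E_eq (i := i) (by omega) β, E_eq (i := i + 1) (by omega) β]
  rw [compL_assoc, compL_assoc, compL_assoc,
    ← compL_assoc β (single (cap D (i + 1)).reflect), h2, compL_id_left,
    ← compL_assoc β (single (cap D i).reflect), h1, compL_id_left]

/-- Stripping top lines reduces to `i = 0`. Then the other generator lies below two through lines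
and slides past the arc of `cap D 0`, once on each side of the factorisation of `E`. -/
theorem compL_E_far (β : ℂ) (n i j : ℕ) (h : i + 2 ≤ j) :
    compL β (E n i) (E n j) = compL β (E n j) (E n i) := by
  induction i generalizing n j with
  | zero =>
    rcases Nat.lt_or_ge (j + 1) n with hj | hj
    · obtain ⟨D, rfl⟩ : ∃ D, n = D + 2 := ⟨n - 2, by omega⟩
      obtain ⟨j, rfl⟩ : ∃ j', j = j' + 2 := ⟨j - 2, by omega⟩
      have key : ∀ y : Comb D D, compL β (addTopL (addTopL y)) (single (cap D 0)) =
          compL β (single (cap D 0)) y := by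
        intro y
        rw [cap_zero, ← closeTopL_single, compL_addTopL_closeTopL, compL_id_right,
          compL_closeTopL, compL_id_left]
      have key' : ∀ y : Comb D D, compL β (single (cap D 0).reflect) (addTopL (addTopL y)) =
          compL β y (single (cap D 0).reflect) := by
        intro y
        have := congrArg mirrorL (key (mirrorL y))
        rwa [mirrorL_compL, mirrorL_compL, ← mirrorL_addTopL, ← mirrorL_addTopL, mirrorL_mirrorL,
          mirrorL_mirrorL, mirrorL_single] at this
      rw [E_succ, E_succ, E_eq (i := 0) (by omega) β, compL_assoc, key', ← compL_assoc,
        ← compL_assoc, key]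
    · rw [E_of_le hj]; simp
  | succ i ih =>
    cases n with
    | zero => rw [E_of_le (by omega)]; simp
    | succ n =>
      obtain ⟨j, rfl⟩ : ∃ j', j = j' + 1 := ⟨j - 1, by omega⟩
      rw [E_succ, E_succ, compL_addTopL, compL_addTopL, ih n j (by omega)]

theorem wenzlJones_zero (q : ℂ) (n : ℕ) : wenzlJones q n 0 = single (Diagram.id n) := rfl

theorem wenzlJones_one (q : ℂ) (n : ℕ) : wenzlJones q n 1 = single (Diagram.id n) := rfl

theorem wenzlJones_add_two (q : ℂ) (n k : ℕ) : wenzlJones q n (k + 2) =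
    wenzlJones q n (k + 1) - (qnum q (k + 1) / qnum q (k + 2)) •
      compL (q + q⁻¹) (compL (q + q⁻¹) (wenzlJones q n (k + 1)) (E n (n - (k + 2))))
        (wenzlJones q n (k + 1)) := by
  rw [wenzlJones, comp_eq, comp_eq]

/-- The projector sits at the bottom, so a new top line merely raises the index of each generator in
it by one. -/
theorem wenzlJones_succ (q : ℂ) (n k : ℕ) (hk : k ≤ n) :
    wenzlJones q (n + 1) k = addTopL (wenzlJones q n k) := by
  induction k using Nat.strong_induction_on with
  | _ k ih =>
    match k with
    | 0 => rw [wenzlJones_zero, wenzlJones_zero, addTopL_single, addTop_id]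
    | 1 => rw [wenzlJones_one, wenzlJones_one, addTopL_single, addTop_id]
    | k + 2 =>
      have : n + 1 - (k + 2) = n - (k + 2) + 1 := by omega
      rw [wenzlJones_add_two, wenzlJones_add_two, ih (k + 1) (by omega) (by omega), this, E_succ,
        compL_addTopL, compL_addTopL, map_sub, map_smul]

theorem wenzlJones_annihilates {q : ℂ} (hq : q ≠ 0) (hq' : q - q⁻¹ ≠ 0) {n k : ℕ} (hk : k ≤ n)
    (hqn : ∀ j, 1 ≤ j → j ≤ k → qnum q j ≠ 0) {l : ℕ} (hl : n - k ≤ l) (hln : l + 1 < n) :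
    compL (q + q⁻¹) (E n l) (wenzlJones q n k) = 0 ∧
      compL (q + q⁻¹) (wenzlJones q n k) (E n l) = 0 := by
  -- Left multiplication represents `Comb n n` faithfully in a ring of endomorphisms, where the
  -- abstract result applies.
  have hmul : ∀ x y : Comb n n, (compL (q + q⁻¹) (compL (q + q⁻¹) x y) :
      Module.End ℂ (Comb n n)) = compL (q + q⁻¹) x * compL (q + q⁻¹) y := by
    intro x y
    refine LinearMap.ext fun z => ?_
    exact compL_assoc _ x y z
  have hone : (compL (q + q⁻¹) (single (Diagram.id n)) : Module.End ℂ (Comb n n)) = 1 :=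
    LinearMap.ext fun z => compL_id_left _ z
  have hinj : ∀ x : Comb n n, (compL (q + q⁻¹) x : Module.End ℂ (Comb n n)) = 0 → x = 0 := by
    intro x hx
    rw [← compL_id_right (q + q⁻¹) x, hx]
    rfl
  -- The generators are numbered from the bottom here, since the projectors grow upwards; `E n l`
  -- gets the number `n - 2 - l`.
  have key := (jonesWenzl (R := Module.End ℂ (Comb n n)) (q := q)
    (e := fun i => compL (q + q⁻¹) (E n (n - (i + 2))))
    (p := fun k => compL (q + q⁻¹) (wenzlJones q n k)) (M := n - 1) hq hq'
    (fun i _ => by rw [← hmul, compL_E_self, map_smul])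
    (fun i hi => by
      have h1 : n - (i + 2) = n - (i + 1 + 2) + 1 := by omega
      simp only [h1]
      rw [← hmul, ← hmul, compL_E_adjacent _ (by omega)])
    (fun i j hij hj => by rw [← hmul, ← hmul, ← compL_E_far _ n (n - (j + 2)) (n - (i + 2)) (by omega)])
    hone hone
    (fun k => by
      rw [wenzlJones_add_two, map_sub, map_smul, hmul, hmul])
    (K := k) (by omega) hqn k le_rfl).2 (n - 2 - l) (by omega)
  have h1 : n - (n - 2 - l + 2) = l := by omega
  simp only [h1] at key
  rw [← hmul, ← hmul] at key
  exact ⟨hinj _ key.1, hinj _ key.2⟩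

/-! ### Links between bottom points -/

namespace Diagram

/-- `D'` is what remains of `D` when the link between the two neighbours is split off. -/
theorem exists_eq_concat_cap {n d l : ℕ} (hl : l ≤ n) (D : Diagram (n + 2) d)
    (h : D.mate (Sum.inl ⟨l, by omega⟩) = Sum.inl ⟨l + 1, by omega⟩) :
    ∃ D', concat (cap n l) D' = D ∧ loops (cap n l) D' = 0 := by
  induction l generalizing n d with
  | zero =>
    obtain ⟨D, rfl⟩ := exists_closeTop_eq D
    have h' : turn (D.mate (Sum.inr 0)) = turn (Sum.inl 0) := h
    obtain ⟨D, rfl⟩ := exists_addTop_eq D (by rw [← turn.injective h', D.mate_mate])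
    refine ⟨D, ?_⟩
    rw [cap_zero, (concat_closeTop _ _).1, (concat_closeTop _ _).2, (concat_id_left _).1,
      (concat_id_left _).2]
    exact ⟨rfl, rfl⟩
  | succ l ih =>
    obtain ⟨n, rfl⟩ : ∃ n', n = n' + 1 := ⟨n - 1, by omega⟩
    obtain ⟨D, rfl⟩ := exists_closeTop_eq D
    have h' : turn (D.mate (Sum.inl ⟨l, by omega⟩)) = turn (Sum.inl ⟨l + 1, by omega⟩) := h
    obtain ⟨D', h1, h2⟩ := ih (by omega) D (turn.injective h')
    refine ⟨D'.closeTop, ?_⟩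
    rw [cap_succ, (concat_addTop_closeTop _ _).1, (concat_addTop_closeTop _ _).2, h1, h2]
    exact ⟨rfl, rfl⟩

/-- Induction on a bound for the length of the link: if it is not between neighbours, the point just
below `i` must be joined inside the link, by a shorter one. The bound `i ≤ l` is enough to stay
among the bottom points. -/
theorem exists_adjacent_link {m d : ℕ} (D : Diagram m d) (g : ℕ) :
    ∀ i j : Fin m, (i : ℕ) < j → (j : ℕ) ≤ i + g → D.mate (Sum.inl i) = Sum.inl j →
      ∃ (l : ℕ) (hl : l + 1 < m), (i : ℕ) ≤ l ∧
        D.mate (Sum.inl ⟨l, by omega⟩) = Sum.inl ⟨l + 1, hl⟩ := by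
  induction g with
  | zero => intro i j h1 h2; omega
  | succ g ih =>
    intro i j h1 h2 h
    have hj := j.2
    by_cases hij : (j : ℕ) = i + 1
    · refine ⟨i, by omega, le_rfl, ?_⟩
      rw [h]
      exact congrArg _ (Fin.ext hij)
    · have h' : D.mate (Sum.inl j) = Sum.inl i := by rw [← h, D.mate_mate]
      have c1 := D.noncrossing (Sum.inl i) (Sum.inl ⟨i + 1, by omega⟩)
      have c2 := D.noncrossing (D.mate (Sum.inl ⟨i + 1, by omega⟩)) (Sum.inl i)
      have c3 := D.mate_mate (Sum.inl ⟨i + 1, by omega⟩)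
      have c4 := D.mate_ne (Sum.inl ⟨i + 1, by omega⟩)
      rcases hx : D.mate (Sum.inl ⟨i + 1, by omega⟩) with x | x
      · rw [hx] at c1 c2 c3 c4
        rw [c3] at c2
        rw [h] at c1 c2
        have x1 : (x : ℕ) ≠ i := by
          intro hc
          have : x = i := Fin.ext hc
          rw [this, h] at c3
          have := congrArg Fin.val (Sum.inl_injective c3)
          simp only at this
          omega
        have x2 : (x : ℕ) ≠ j := by
          intro hc
          have : x = j := Fin.ext hc
          rw [this, h'] at c3
          have := congrArg Fin.val (Sum.inl_injective c3)
          simp only at this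
          omega
        have x3 : (x : ℕ) ≠ i + 1 := fun hc => c4 (congrArg _ (Fin.ext hc))
        simp only [pos] at c1 c2
        obtain ⟨l, hl, hl1, hl2⟩ := ih ⟨i + 1, by omega⟩ x (by simp only; omega)
          (by simp only; omega) hx
        simp only at hl1
        exact ⟨l, hl, by omega, hl2⟩
      · rw [hx, h] at c1
        simp only [pos] at c1
        omega

end Diagram

theorem compL_E_of_link (β : ℂ) {m d l : ℕ} (D : Diagram m d) (hl : l + 1 < m)
    (h : D.mate (Sum.inl ⟨l, by omega⟩) = Sum.inl ⟨l + 1, hl⟩) :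
    compL β (E m l) (single D) = β • single D := by
  obtain ⟨n, rfl⟩ : ∃ n, m = n + 2 := ⟨m - 2, by omega⟩
  obtain ⟨D', rfl, h2⟩ := exists_eq_concat_cap (by omega) D h
  have : single (concat (cap n l) D') = compL β (single (cap n l)) (single D') := by
    rw [compL_single, h2, pow_zero, one_smul]
  rw [this, E_eq (by omega) β, compL_assoc, ← compL_assoc β (single (cap n l).reflect),
    compL_cap_self, map_smul, LinearMap.smul_apply, compL_id_left, map_smul]

/-- There is a link between neighbours `l`, `l + 1` inside the range of the projector, so `E m l`
multiplies the diagram by `β`, while the projector annihilates `E m l`. Two distinct points in the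
range force `2 ≤ k`, hence `β = [2] ≠ 0`. -/
theorem wenzlJones_single_eq_zero {q : ℂ} (hq : q ≠ 0) (hq' : q - q⁻¹ ≠ 0) {m k d : ℕ}
    (hk : k ≤ m) (hqn : ∀ j, 1 ≤ j → j ≤ k → qnum q j ≠ 0) (D : Diagram m d) {i j : Fin m}
    (hi : m - k ≤ i) (hj : m - k ≤ j) (h : D.mate (Sum.inl i) = Sum.inl j) :
    compL (q + q⁻¹) (wenzlJones q m k) (single D) = 0 := by
  wlog hij : (i : ℕ) < j generalizing i j
  · refine this hj hi (by rw [← h, D.mate_mate]) ?_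
    have : (i : ℕ) ≠ j := fun hc => D.mate_ne (Sum.inl i) (by rw [h, Fin.ext hc])
    omega
  have hk2 : 2 ≤ k := by omega
  have hβ : q + q⁻¹ ≠ 0 := by
    rw [← qnum_two hq hq']; exact hqn 2 (by omega) hk2
  obtain ⟨l, hl, hil, hlink⟩ := exists_adjacent_link D (j - i) i j hij (by omega) h
  have h1 := compL_E_of_link (q + q⁻¹) D hl hlink
  have h2 := (wenzlJones_annihilates hq hq' hk hqn (l := l) (by omega) hl).2
  have h3 : (q + q⁻¹) • compL (q + q⁻¹) (wenzlJones q m k) (single D) = 0 := by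
    rw [← map_smul, ← h1, ← compL_assoc, h2, map_zero, LinearMap.zero_apply]
  exact (smul_eq_zero.1 h3).resolve_left hβ

/-- Composition on the left cannot make a diagram monic, so computations may be done modulo
non-monic diagrams in the right factor. -/
theorem compL_eq_zero_of_isMonic (β : ℂ) {m d e : ℕ} (x : Comb m d) {y : Comb d e}
    (hy : ∀ D : Diagram d e, D.IsMonic → y D = 0) {c : Diagram m e} (hc : c.IsMonic) :
    compL β x y c = 0 := by
  rw [compL_apply]
  refine Finset.sum_eq_zero fun a _ => Finset.sum_eq_zero fun b _ => ?_
  split_ifs with h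
  · rw [hy b (isMonic_of_concat (h ▸ hc))]; simp
  · simp

/-! ### The bilinear form and the tridiagonal pairing of caps -/

/-- The bilinear form whose value is the coefficient of the identity in `x^* y`. -/
noncomputable def form (β : ℂ) {m d : ℕ} : Comb m d →ₗ[ℂ] Comb m d →ₗ[ℂ] ℂ :=
  ((compL β).comp mirrorL).compr₂ (LinearMap.proj (Diagram.id d))

theorem form_apply (β : ℂ) {m d : ℕ} (x y : Comb m d) :
    form β x y = compL β (mirrorL x) y (Diagram.id d) := rfl

theorem mirrorL_apply_id {d : ℕ} (x : Comb d d) :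
    mirrorL x (Diagram.id d) = x (Diagram.id d) := by
  rw [mirrorL_apply, reflect_id]

theorem compL_apply_id (β : ℂ) {m d : ℕ} (x : Comb d m) (y : Comb m d) :
    compL β x y (Diagram.id d) = compL β (mirrorL y) (mirrorL x) (Diagram.id d) := by
  rw [← mirrorL_compL, mirrorL_apply_id]

theorem form_comm (β : ℂ) {m d : ℕ} (x y : Comb m d) : form β x y = form β y x := by
  rw [form_apply, form_apply, compL_apply_id, mirrorL_mirrorL]

theorem form_addTopL (β : ℂ) {m d : ℕ} (x y : Comb m d) :
    form β (addTopL x) (addTopL y) = form β x y := by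
  rw [form_apply, form_apply, mirrorL_addTopL, compL_addTopL, ← addTop_id, addTopL_apply]

/-- Equal caps close a loop, neighbouring caps straighten to the identity, and distant caps do not
give the identity. -/
theorem compL_cap_apply_id (β : ℂ) {D i j : ℕ} (hi : i ≤ D) (hj : j ≤ D) :
    compL β (single (cap D j).reflect) (single (cap D i)) (Diagram.id D) =
      (if i = j then β else 0) + (if i + 1 = j then 1 else 0) + (if i = j + 1 then 1 else 0) := by
  rw [compL_single, Pi.smul_apply, single_apply, smul_eq_mul]
  rcases lt_trichotomy i j with h | rfl | h
  · by_cases h' : i + 1 = j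
    · subst h'
      rw [(cap_snake D i (by omega)).1, (cap_snake D i (by omega)).2]
      simp
      omega
    · rw [if_neg (cap_far D i j hj (by omega)).symm, if_neg (by omega), if_neg h',
        if_neg (by omega)]
      simp
  · rw [(cap_loop D i).1, (cap_loop D i).2]
    simp
  · by_cases h' : i = j + 1
    · subst h'
      rw [(cap_snake' D j (by omega)).1, (cap_snake' D j (by omega)).2]
      simp
      omega
    · rw [if_neg (cap_far' D j i hi (by omega)).symm, if_neg (by omega), if_neg (by omega),
        if_neg h']
      simp

/-- The combination of the diagrams `cap D i`, `i ≤ D`, with coefficients `c i`. -/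
noncomputable def capSum (D : ℕ) (c : ℕ → ℂ) : Comb (D + 2) D :=
  ∑ i ∈ Finset.range (D + 1), c i • single (cap D i)

theorem capSum_cap (D : ℕ) (c : ℕ → ℂ) {j : ℕ} (hj : j ≤ D) : capSum D c (cap D j) = c j := by
  simp only [capSum, Finset.sum_apply, Pi.smul_apply, single_apply, smul_eq_mul]
  rw [Finset.sum_eq_single j]
  · simp
  · intro i hi hij
    rw [if_neg, mul_zero]
    intro h
    exact hij (cap_injOn D j hj i (by simpa [Nat.lt_succ_iff] using hi) h).symm
  · intro h
    simp at h
    omega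

/-- The condition `c (D + 1) = 0` lets the last row of the tridiagonal system take the same form as
the others. -/
theorem compL_capSum_apply_id (β : ℂ) {D j : ℕ} (c : ℕ → ℂ) (hj : j ≤ D) (hc : c (D + 1) = 0) :
    compL β (single (cap D j).reflect) (capSum D c) (Diagram.id D) =
      β * c j + (if j = 0 then 0 else c (j - 1)) + c (j + 1) := by
  have h1 : compL β (single (cap D j).reflect) (capSum D c) (Diagram.id D) =
      ∑ i ∈ Finset.range (D + 1), c i * ((if i = j then β else 0) +
        (if i + 1 = j then 1 else 0) + (if i = j + 1 then 1 else 0)) := by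
    simp only [capSum, map_sum, map_smul, Finset.sum_apply, Pi.smul_apply, smul_eq_mul]
    refine Finset.sum_congr rfl fun i hi => ?_
    rw [compL_cap_apply_id β (by simpa [Nat.lt_succ_iff] using hi) hj]
  rw [h1]
  simp only [mul_add, Finset.sum_add_distrib, mul_ite, mul_one, mul_zero, Finset.sum_ite_eq',
    Finset.mem_range]
  rw [if_pos (by omega), mul_comm]
  congr 1
  · congr 1
    cases j with
    | zero => simp
    | succ j =>
      simp only [add_left_inj, Finset.sum_ite_eq', Finset.mem_range]
      rw [if_pos (by omega), if_neg (by omega)]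
      rfl
  · split_ifs with h
    · rfl
    · obtain rfl : j = D := by omega
      exact hc.symm

/-- The coefficients of the projector `P_{d+2}` on the diagrams with at most one right link, which
joins the two topmost points. -/
noncomputable def projCoeff (q : ℂ) (d i : ℕ) : ℂ :=
  (-1) ^ i * qnum q (d + 2 - i) / qnum q (d + 2)

theorem projCoeff_zero {q : ℂ} {d : ℕ} (hd : qnum q (d + 2) ≠ 0) : projCoeff q d 0 = 1 := by
  simp [projCoeff, div_self hd]

theorem projCoeff_last (q : ℂ) (d : ℕ) : projCoeff q d (d + 2) = 0 := by
  simp [projCoeff, qnum_zero]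

theorem projCoeff_rec {q : ℂ} (hq : q ≠ 0) {d j : ℕ} (hj : j ≤ d) :
    (q + q⁻¹) * projCoeff q d (j + 1) + projCoeff q d j + projCoeff q d (j + 2) = 0 := by
  obtain ⟨m, rfl⟩ : ∃ m, d = m + j := ⟨d - j, by omega⟩
  have h1 : m + j + 2 - (j + 1) = m + 1 := by omega
  have h2 : m + j + 2 - j = m + 2 := by omega
  have h3 : m + j + 2 - (j + 2) = m := by omega
  simp only [projCoeff, h1, h2, h3, qnum_add_two hq m]
  ring

/-- The recursion is solved downwards from `c (d + 2) = 0`: the solutions are multiples of the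
alternating quantum integers, and `c 0 = 1` fixes the multiple. -/
theorem projCoeff_unique {q : ℂ} (hq : q ≠ 0) (hq' : q - q⁻¹ ≠ 0) {d : ℕ}
    (hd : qnum q (d + 2) ≠ 0) {c : ℕ → ℂ} (h0 : c 0 = 1) (hl : c (d + 2) = 0)
    (hrec : ∀ j ≤ d, (q + q⁻¹) * c (j + 1) + c j + c (j + 2) = 0) {i : ℕ} (hi : i ≤ d + 2) :
    c i = projCoeff q d i := by
  have key : ∀ m i, i + m = d + 2 → c i = (-1) ^ (m + 1) * qnum q m * c (d + 1) := by
    intro m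
    induction m using Nat.strong_induction_on with
    | _ m ih =>
      intro i hi
      match m with
      | 0 =>
        obtain rfl : i = d + 2 := by omega
        rw [hl, qnum_zero]; ring
      | 1 =>
        obtain rfl : i = d + 1 := by omega
        rw [qnum_one hq']; ring
      | m + 2 =>
        have h1 := ih (m + 1) (by omega) (i + 1) (by omega)
        have h2 := ih m (by omega) (i + 2) (by omega)
        have h3 := hrec i (by omega)
        rw [h1, h2] at h3
        rw [qnum_add_two hq]
        linear_combination h3
  obtain ⟨m, hm⟩ : ∃ m, i + m = d + 2 := ⟨d + 2 - i, by omega⟩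
  have h1 := key m i hm
  have h2 := key (d + 2) 0 (by omega)
  rw [h0] at h2
  have h3 : d + 2 - i = m := by omega
  rw [projCoeff, h3, eq_div_iff hd, h1]
  have h4 : ((-1 : ℂ)) ^ i * (-1) ^ i = 1 := by rw [← mul_pow]; simp
  have h5 : ((-1 : ℂ)) ^ (d + 2 + 1) = (-1) ^ i * (-1) ^ (m + 1) := by
    rw [← pow_add]; congr 1; omega
  rw [h5] at h2
  linear_combination (-(1 : ℂ)) * (-1) ^ i * qnum q m * h2 - (-1) ^ (m + 1) * qnum q m * c (d + 1) * qnum q (d + 2) * h4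

/-- The rows `j + 1` of the tridiagonal system vanish by `projCoeff_rec`; row `0` has no preceding
term and leaves `β - [d + 1] / [d + 2] = [d + 3] / [d + 2]`. If `y.reflect` is not monic, the
product has no identity term. -/
theorem compL_capSum_projCoeff {q : ℂ} (hq : q ≠ 0) {d : ℕ} (hd : qnum q (d + 2) ≠ 0)
    (y : Diagram (d + 1) (d + 3)) :
    compL (q + q⁻¹) (single y) (capSum (d + 1) (projCoeff q d)) (Diagram.id (d + 1)) =
      if y.reflect = cap (d + 1) 0 then qnum q (d + 3) / qnum q (d + 2) else 0 := by
  by_cases hy : y.reflect.IsMonic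
  · obtain ⟨j, hj, hj'⟩ := hy.eq_cap
    have hy' : y = (cap (d + 1) j).reflect := by rw [← hj', reflect_reflect]
    rw [hj', hy', compL_capSum_apply_id _ _ hj (projCoeff_last q d)]
    cases j with
    | zero =>
      rw [if_pos rfl, if_pos rfl, projCoeff_zero hd, eq_div_iff hd]
      have h1 : d + 2 - (0 + 1) = d + 1 := by omega
      simp only [projCoeff, h1]
      rw [qnum_add_two hq (d + 1)]
      field_simp
      ring
    | succ j =>
      rw [if_neg (by omega), if_neg (cap_succ_ne_cap_zero d j)]
      exact projCoeff_rec hq (by omega)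
  · rw [if_neg fun h => hy (by rw [h]; exact isMonic_cap _ _), compL_apply_id, mirrorL_single]
    refine compL_eq_zero_of_isMonic _ _ (fun D hD => ?_) (isMonic_id _)
    rw [single_apply, if_neg]
    rintro rfl
    exact hy hD

theorem addTop_ne_cap_zero {d : ℕ} (D : Diagram (d + 2) d) : D.addTop ≠ cap (d + 1) 0 := by
  intro h
  have h1 : D.addTop.mate (Sum.inl 0) = Sum.inr 0 := rfl
  have h2 : (cap (d + 1) 0).mate (Sum.inl 0) = Sum.inl 1 := by
    rw [cap_zero]; rfl
  rw [h, h2] at h1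
  simp at h1

/-- Multiplying the two vectors first leaves diagrams with a through line at the top, and no such
diagram is a reflected `cap (d + 1) 0`. -/
theorem form_addTopL_proj {q : ℂ} (hq : q ≠ 0) {m d : ℕ} (hd : qnum q (d + 2) ≠ 0)
    (y : Comb m d) (x : Comb m (d + 2)) :
    form (q + q⁻¹) (addTopL y)
      (compL (q + q⁻¹) (addTopL x) (capSum (d + 1) (projCoeff q d))) = 0 := by
  rw [form_apply, mirrorL_addTopL, ← compL_assoc, compL_addTopL]
  induction (compL (q + q⁻¹)) (mirrorL y) x using comb_induction with
  | hadd x y hx hy => simp [hx, hy]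
  | hsmul c x hx => simp [hx]
  | hzero => simp
  | hsingle D =>
    rw [addTopL_single, compL_capSum_projCoeff hq hd, reflect_addTop, if_neg]
    exact addTop_ne_cap_zero _

/-- Bending is composition with `cap (d + 1) 0`. A diagram `D` occurring in `y^* x` then contributes
through its bent version, which is `cap (d + 1) 0` exactly when `D` is the identity. -/
theorem form_closeTopL_proj {q : ℂ} (hq : q ≠ 0) {m d : ℕ} (hd : qnum q (d + 2) ≠ 0)
    (y x : Comb m (d + 2)) :
    form (q + q⁻¹) (closeTopL y)
      (compL (q + q⁻¹) (addTopL x) (capSum (d + 1) (projCoeff q d))) =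
      qnum q (d + 3) / qnum q (d + 2) * form (q + q⁻¹) y x := by
  have h : closeTopL y = compL (q + q⁻¹) (addTopL y) (single (cap (d + 1) 0)) := by
    rw [cap_zero, ← closeTopL_single, compL_addTopL_closeTopL, compL_id_right]
  rw [form_apply, form_apply, h, mirrorL_compL, mirrorL_addTopL, ← compL_assoc,
    compL_assoc _ _ (addTopL _) (addTopL _), compL_addTopL]
  induction (compL (q + q⁻¹)) (mirrorL y) x using comb_induction with
  | hadd x y hx hy => simp [hx, hy, mul_add]
  | hsmul c x hx => simp [hx]; ring
  | hzero => simp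
  | hsingle D =>
    have h1 : compL (q + q⁻¹) (mirrorL (single (cap (d + 1) 0))) (addTopL (single D)) =
        single D.reflect.closeTop.reflect := by
      have : addTopL (single D) = mirrorL (addTopL (single D.reflect)) := by
        rw [mirrorL_addTopL, mirrorL_single, reflect_reflect]
      rw [this, ← mirrorL_compL, cap_zero, ← closeTopL_single, compL_addTopL_closeTopL,
        compL_id_right, closeTopL_single, mirrorL_single]
    rw [h1, compL_capSum_projCoeff hq hd, reflect_reflect, cap_zero, single_apply]
    have h2 : D.reflect = Diagram.id (d + 1 + 1) ↔ Diagram.id (d + 2) = D := by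
      rw [← reflect_injective.eq_iff, reflect_reflect, reflect_id, eq_comm]
    simp only [closeTop_injective.eq_iff, h2, mul_ite, mul_one, mul_zero]

/-! ### The bent Wenzl–Jones projector -/

theorem E_apply_of_isMonic (n l : ℕ) {D : Diagram n n} (hD : D.IsMonic) : E n l D = 0 := by
  by_cases h : l + 1 < n
  · rw [E, dif_pos h, single_apply, if_neg]
    rintro rfl
    obtain ⟨i, hi⟩ := hD ⟨l, by omega⟩
    simp [gen, genMate] at hi
  · rw [E_of_le (by omega)]; rfl

theorem wenzlJones_apply_id (q : ℂ) (n k : ℕ) : wenzlJones q n k (Diagram.id n) = 1 := by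
  induction k using Nat.strong_induction_on with
  | _ k ih =>
    match k with
    | 0 => simp [wenzlJones_zero, single_apply]
    | 1 => simp [wenzlJones_one, single_apply]
    | k + 2 =>
      -- The correction term contains a generator, so it has no identity term; reflection moves the
      -- generator into the right factor.
      rw [wenzlJones_add_two, Pi.sub_apply, ih (k + 1) (by omega), Pi.smul_apply,
        compL_apply_id, compL_eq_zero_of_isMonic _ _ _ (isMonic_id _)]
      · simp
      · intro D hD
        rw [hD.eq_id, mirrorL_apply_id]
        exact compL_eq_zero_of_isMonic _ _ (fun D hD => E_apply_of_isMonic _ _ hD) (isMonic_id _)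

/-- Up to diagrams that are not monic, closing the topmost right point of the projector `P_{d+2}`
gives the combination of caps with coefficients `projCoeff`. -/
theorem closeTopL_wenzlJones {q : ℂ} (hq : q ≠ 0) (hq' : q - q⁻¹ ≠ 0) {d : ℕ}
    (hqn : ∀ j, 1 ≤ j → j ≤ d + 2 → qnum q j ≠ 0) {D : Diagram (d + 3) (d + 1)}
    (hD : D.IsMonic) :
    closeTopL (wenzlJones q (d + 2) (d + 2)) D = capSum (d + 1) (projCoeff q d) D := by
  set a : Comb (d + 3) (d + 1) := closeTopL (wenzlJones q (d + 2) (d + 2)) with ha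
  have hβ : q + q⁻¹ ≠ 0 := by
    rw [← qnum_two hq hq']; exact hqn 2 (by omega) (by omega)
  -- The extension by zero supplies the end condition `c (d + 2) = 0` of the recursion.
  let c : ℕ → ℂ := fun i => if i ≤ d + 1 then a (cap (d + 1) i) else 0
  have hac : ∀ D : Diagram (d + 3) (d + 1), D.IsMonic → (a - capSum (d + 1) c) D = 0 := by
    intro D hD
    obtain ⟨i, hi, rfl⟩ := hD.eq_cap
    rw [Pi.sub_apply, capSum_cap _ _ hi]
    simp [c, hi]
  have hc0 : c 0 = 1 := by
    simp only [c]
    rw [if_pos (by omega), cap_zero, ha, closeTopL_apply, wenzlJones_apply_id]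
  have hcl : c (d + 2) = 0 := by simp [c]
  have hrec : ∀ j ≤ d, (q + q⁻¹) * c (j + 1) + c j + c (j + 2) = 0 := by
    intro j hj
    -- The new left point is on top, so the generators of index at least one still act on the
    -- projector and annihilate it.
    have h1 : compL (q + q⁻¹) (E (d + 3) (j + 1)) a = 0 := by
      rw [E_succ, ha, compL_addTopL_closeTopL,
        (wenzlJones_annihilates hq hq' le_rfl hqn (by omega) (by omega)).1, map_zero]
    have h2 : compL (q + q⁻¹) (single (cap (d + 1) (j + 1)).reflect) a = 0 := by
      have h3 := congrArg (compL (q + q⁻¹) (single (cap (d + 1) (j + 1)).reflect)) h1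
      rw [E_eq (by omega) (q + q⁻¹), compL_assoc, ← compL_assoc _ (single _) (single _) (compL _ _ _),
        compL_cap_self, map_smul, LinearMap.smul_apply, compL_id_left, map_zero] at h3
      exact (smul_eq_zero.1 h3).resolve_left hβ
    have h4 := compL_eq_zero_of_isMonic (q + q⁻¹) (single (cap (d + 1) (j + 1)).reflect) hac
      (isMonic_id (d + 1))
    rw [map_sub, h2, zero_sub, Pi.neg_apply, neg_eq_zero,
      compL_capSum_apply_id _ _ (by omega) hcl, if_neg (by omega)] at h4
    exact h4
  obtain ⟨i, hi, rfl⟩ := hD.eq_cap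
  have := projCoeff_unique hq hq' (hqn _ (by omega) le_rfl) hc0 hcl hrec (i := i) (by omega)
  rw [capSum_cap _ _ hi, ← this]
  simp [c, hi]

/-! ### The seam basis and its two families -/

/-- The source of unitriangularity: the cap with index `0` has coefficient `1` and bends `x`, and
every other cap carries a through line at the top. -/
theorem compL_capSum_projCoeff_eq {q : ℂ} {m d : ℕ} (hd : qnum q (d + 2) ≠ 0)
    (x : Comb m (d + 2)) :
    compL (q + q⁻¹) (addTopL x) (capSum (d + 1) (projCoeff q d)) =
      closeTopL x + addTopL (∑ i ∈ Finset.range (d + 1),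
        projCoeff q d (i + 1) • compL (q + q⁻¹) x (single (cap d i))) := by
  rw [capSum, Finset.sum_range_succ', map_add, projCoeff_zero hd, one_smul, cap_zero,
    ← closeTopL_single, compL_addTopL_closeTopL, compL_id_right, add_comm (closeTopL x)]
  simp only [map_sum, map_smul, cap_succ, ← addTopL_single, compL_addTopL]

theorem seamVector_eq (q : ℂ) {n k d : ℕ} (w : SeamDiagram n k d) :
    seamVector q w = compL (q + q⁻¹) (wenzlJones q (k + n) k) (single w.1) := by
  rw [seamVector, comp_eq]

theorem gram_eq (q : ℂ) {n k d : ℕ} (v w : SeamDiagram n k d) :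
    gram q n k d v w = form (q + q⁻¹) (seamVector q v) (seamVector q w) := by
  rw [gram, Matrix.of_apply, comp_eq, mirror_eq, form_apply]

theorem seamVector_addTop (q : ℂ) {n k d : ℕ} (w : SeamDiagram n k d)
    {v : SeamDiagram (n + 1) k (d + 1)} (h : v.1 = w.1.addTop) :
    seamVector q v = addTopL (seamVector q w) := by
  rw [seamVector_eq, seamVector_eq, h, ← compL_addTopL, ← wenzlJones_succ q _ _ (by omega),
    addTopL_single]
  rfl

theorem seamVector_closeTop (q : ℂ) {n k d : ℕ} (w : SeamDiagram n k (d + 1))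
    {v : SeamDiagram (n + 1) k d} (h : v.1 = w.1.closeTop) :
    seamVector q v = closeTopL (seamVector q w) := by
  rw [seamVector_eq, seamVector_eq, h, ← compL_addTopL_closeTopL,
    ← wenzlJones_succ q _ _ (by omega), closeTopL_single]
  rfl

/-- The coordinates of `P_k w` composed with `cap d i`. -/
theorem compL_seamVector_cap {q : ℂ} (hq : q ≠ 0) (hq' : q - q⁻¹ ≠ 0) {n k d : ℕ}
    (hqn : ∀ j, 1 ≤ j → j ≤ k → qnum q j ≠ 0) (w : SeamDiagram n k (d + 2)) (i : ℕ) :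
    compL (q + q⁻¹) (seamVector q w) (single (cap d i)) =
      ∑ v : SeamDiagram n k d, (if v.1 = concat w.1 (cap d i) then
        (q + q⁻¹) ^ loops w.1 (cap d i) else 0) • seamVector q v := by
  rw [seamVector_eq, compL_assoc, compL_single, map_smul]
  -- Either the concatenation indexes a basis vector, or it has a link between two boundary points
  -- and the projector kills it; in the latter case no index `v` matches and the sum is empty as
  -- well.
  by_cases h : ∀ a b : Fin (k + n), n ≤ (a : ℕ) → n ≤ (b : ℕ) →
      (concat w.1 (cap d i)).mate (Sum.inl a) ≠ Sum.inl b
  · let u : SeamDiagram n k d := ⟨_, isMonic_concat w.2.1 (isMonic_cap d i), h⟩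
    rw [Finset.sum_eq_single u, if_pos rfl, seamVector_eq]
    · intro v _ hv
      rw [if_neg fun hc => hv (Subtype.ext hc), zero_smul]
    · simp
  · have h' := h
    push Not at h'
    obtain ⟨a, b, ha, hb, hab⟩ := h'
    rw [wenzlJones_single_eq_zero hq hq' (by omega) hqn _ (by omega) (by omega) hab, smul_zero,
      Finset.sum_eq_zero]
    intro v _
    rw [if_neg fun hc => h (by rw [← hc]; exact v.2.2), zero_smul]

theorem exists_seam_equiv (n k d : ℕ) :
    ∃ e : SeamDiagram n k d ⊕ SeamDiagram n k (d + 2) ≃ SeamDiagram (n + 1) k (d + 1),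
      (∀ v, (e (Sum.inl v)).1 = v.1.addTop) ∧ ∀ w, (e (Sum.inr w)).1 = w.1.closeTop := by
  have hadd : ∀ D : Diagram (k + n) d, (∀ i j : Fin (k + n), n ≤ (i : ℕ) → n ≤ (j : ℕ) →
      D.mate (Sum.inl i) ≠ Sum.inl j) ↔ ∀ i j : Fin (k + n + 1), n + 1 ≤ (i : ℕ) →
      n + 1 ≤ (j : ℕ) → D.addTop.mate (Sum.inl i) ≠ Sum.inl j := by
    intro D
    have hm : ∀ i, D.addTop.mate (Sum.inl i.succ) = shift (D.mate (Sum.inl i)) := fun _ => rfl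
    constructor
    · intro h i j
      refine Fin.cases (fun hi => by simp at hi) (fun i hi => ?_) i
      refine Fin.cases (fun hj => by simp at hj) (fun j hj hc => ?_) j
      rw [Fin.val_succ] at hi hj
      rw [hm] at hc
      exact h i j (by omega) (by omega) (shift_injective hc)
    · intro h i j hi hj hc
      refine h i.succ j.succ (by simpa using hi) (by simpa using hj) ?_
      rw [hm, hc]
      rfl
  have hclose : ∀ D : Diagram (k + n) (d + 2), (∀ i j : Fin (k + n), n ≤ (i : ℕ) → n ≤ (j : ℕ) →
      D.mate (Sum.inl i) ≠ Sum.inl j) ↔ ∀ i j : Fin (k + n + 1), n + 1 ≤ (i : ℕ) →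
      n + 1 ≤ (j : ℕ) → D.closeTop.mate (Sum.inl i) ≠ Sum.inl j := by
    intro D
    have hm : ∀ i, D.closeTop.mate (Sum.inl i.succ) = turn (D.mate (Sum.inl i)) := fun _ => rfl
    constructor
    · intro h i j
      refine Fin.cases (fun hi => by simp at hi) (fun i hi => ?_) i
      refine Fin.cases (fun hj => by simp at hj) (fun j hj hc => ?_) j
      rw [Fin.val_succ] at hi hj
      rw [hm] at hc
      exact h i j (by omega) (by omega) (turn.injective hc)
    · intro h i j hi hj hc
      refine h i.succ j.succ (by simpa using hi) (by simpa using hj) ?_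
      rw [hm, hc]
      rfl
  let f : SeamDiagram n k d ⊕ SeamDiagram n k (d + 2) → SeamDiagram (n + 1) k (d + 1) :=
    Sum.elim (fun v => ⟨v.1.addTop, (isMonic_addTop _).2 v.2.1, (hadd _).1 v.2.2⟩)
      (fun w => ⟨w.1.closeTop, isMonic_closeTop w.2.1, (hclose _).1 w.2.2⟩)
  -- The topmost right point of the monic `w` is joined to the left, so after bending the top left
  -- point has a left partner.
  have hne : ∀ (v : SeamDiagram n k d) (w : SeamDiagram n k (d + 2)),
      v.1.addTop ≠ w.1.closeTop := by
    intro v w h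
    have h1 : v.1.addTop.mate (Sum.inl 0) = Sum.inr 0 := rfl
    have h2 : w.1.closeTop.mate (Sum.inl 0) = turn (w.1.mate (Sum.inr 0)) := rfl
    obtain ⟨i, hi⟩ := w.2.1 0
    rw [h, h2, hi] at h1
    exact Sum.inl_ne_inr h1
  have hf : Function.Bijective f := by
    constructor
    · rintro (v | v) (w | w) h <;> have h := congrArg Subtype.val h
      · exact congrArg _ (Subtype.ext (addTop_injective h))
      · exact absurd h (hne v w)
      · exact absurd h.symm (hne w v)
      · exact congrArg _ (Subtype.ext (closeTop_injective h))
    · rintro ⟨D, hD, hs⟩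
      rcases IsMonic.cases (m := k + n) hD with ⟨d', hd, D', hD', he⟩ | ⟨D', hD', he⟩
      · obtain rfl : d = d' := by omega
        change D = _ at he
        subst he
        exact ⟨Sum.inl ⟨D', hD', (hadd _).2 hs⟩, rfl⟩
      · subst he
        exact ⟨Sum.inr ⟨D', hD', (hclose _).2 hs⟩, rfl⟩
  exact ⟨Equiv.ofBijective f hf, fun _ => rfl, fun _ => rfl⟩

end TemperleyLieb

theorem mainTheorem6 (q : ℂ) (n k d : ℕ) (hq : q ≠ 0) (hk : 2 ≤ k)
    (hroot : ∀ j : ℕ, 1 ≤ j → j ≤ k → q ^ (2 * j) ≠ 1)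
    (hd : qnum q (d + 2) ≠ 0) :
    ∃ (e : SeamDiagram n k d ⊕ SeamDiagram n k (d + 2) ≃ SeamDiagram (n + 1) k (d + 1))
      (U : Matrix (SeamDiagram (n + 1) k (d + 1)) (SeamDiagram (n + 1) k (d + 1)) ℂ)
      (A : Matrix (SeamDiagram n k d) (SeamDiagram n k (d + 2)) ℂ),
      (∀ v, (e (Sum.inl v)).1 = v.1.addTop) ∧
      (∀ w, (e (Sum.inr w)).1 = w.1.closeTop) ∧
      U.submatrix e e = Matrix.fromBlocks 1 A 0 1 ∧
      (U.transpose * gram q (n + 1) k (d + 1) * U).submatrix e e =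
        Matrix.fromBlocks (gram q n k d) 0 0
          ((qnum q (d + 3) / qnum q (d + 2)) • gram q n k (d + 2)) ∧
      ((∀ j : ℕ, 1 ≤ j → j ≤ d + 2 → qnum q j ≠ 0) →
        ∀ w : SeamDiagram n k (d + 2),
          EqModNonMonic (∑ v, U v (e (Sum.inr w)) • seamVector q v) (projectedVector q w)) := by
  classical
  -- With a zero denominator `qnum` would be `0` by the convention for division, against `hd`.
  have hq' : q - q⁻¹ ≠ 0 := by
    intro h
    apply hd
    rw [qnum, h, div_zero]
  have hqn : ∀ j, 1 ≤ j → j ≤ k → qnum q j ≠ 0 := fun j h1 h2 =>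
    qnum_ne_zero hq hq' (hroot j h1 h2)
  obtain ⟨e, he1, he2⟩ := exists_seam_equiv n k d
  -- The coordinates in `F₁` of the terms with cap index `i + 1`, after their top through line has
  -- been removed.
  let A : Matrix (SeamDiagram n k d) (SeamDiagram n k (d + 2)) ℂ := Matrix.of fun v w =>
    ∑ i ∈ Finset.range (d + 1), projCoeff q d (i + 1) *
      (if v.1 = Diagram.concat w.1 (Diagram.cap d i) then
        (q + q⁻¹) ^ Diagram.loops w.1 (Diagram.cap d i) else 0)
  let F : Matrix (SeamDiagram n k d ⊕ SeamDiagram n k (d + 2))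
    (SeamDiagram n k d ⊕ SeamDiagram n k (d + 2)) ℂ := Matrix.fromBlocks 1 A 0 1
  let U := F.submatrix e.symm e.symm
  have hUF : ∀ z z', U (e z) (e z') = F z z' := fun z z' => by simp [U]
  have hUl : ∀ v, ∑ u, U u (e (Sum.inl v)) • seamVector q u = addTopL (seamVector q v) := by
    intro v
    rw [← e.sum_comp, Fintype.sum_sum_type]
    simp [hUF, F, Matrix.one_apply, ite_smul, seamVector_addTop q v (he1 v)]
  have hUr : ∀ w, ∑ u, U u (e (Sum.inr w)) • seamVector q u =
      compL (q + q⁻¹) (addTopL (seamVector q w)) (capSum (d + 1) (projCoeff q d)) := by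
    intro w
    rw [← e.sum_comp, Fintype.sum_sum_type, compL_capSum_projCoeff_eq hd]
    refine (add_comm _ _).trans (congrArg₂ _ ?_ ?_)
    · simp [hUF, F, Matrix.one_apply, ite_smul, seamVector_closeTop q w (he2 w)]
    · have hx : ∑ i ∈ Finset.range (d + 1), projCoeff q d (i + 1) •
          compL (q + q⁻¹) (seamVector q w) (single (Diagram.cap d i)) =
          ∑ v, A v w • seamVector q v := by
        simp only [compL_seamVector_cap hq hq' hqn, Finset.smul_sum]
        rw [Finset.sum_comm]
        refine Finset.sum_congr rfl fun v _ => ?_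
        simp only [A, Matrix.of_apply, Finset.sum_smul, mul_smul]
      rw [hx, map_sum]
      refine Finset.sum_congr rfl fun v _ => ?_
      rw [hUF, seamVector_addTop q v (he1 v), map_smul]
      rfl
  have hG : ∀ z z', (U.transpose * gram q (n + 1) k (d + 1) * U) (e z) (e z') =
      form (q + q⁻¹) (∑ u, U u (e z) • seamVector q u) (∑ u, U u (e z') • seamVector q u) := by
    intro z z'
    simp only [Matrix.mul_apply, Matrix.transpose_apply, gram_eq, map_sum, map_smul,
      LinearMap.sum_apply, LinearMap.smul_apply, smul_eq_mul, Finset.sum_mul]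
    refine Finset.sum_congr rfl fun u _ => ?_
    rw [Finset.mul_sum]
    refine Finset.sum_congr rfl fun u' _ => ?_
    ring
  refine ⟨e, U, A, he1, he2, ?_, ?_, ?_⟩
  · ext z z'
    exact hUF z z'
  · ext z z'
    rw [Matrix.submatrix_apply, hG]
    rcases z with v | v <;> rcases z' with w | w
    · rw [hUl, hUl, form_addTopL, Matrix.fromBlocks_apply₁₁, gram_eq]
    · rw [hUl, hUr, form_addTopL_proj hq hd]
      rfl
    · rw [hUl, hUr, form_comm, form_addTopL_proj hq hd]
      rfl
    · rw [hUr, hUr, Matrix.fromBlocks_apply₂₂, Matrix.smul_apply, smul_eq_mul, gram_eq]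
      -- Only the left argument is split: its part in the image of `addTopL` is orthogonal to the
      -- new vector on the right, so the bent part alone contributes.
      nth_rewrite 1 [compL_capSum_projCoeff_eq hd]
      rw [map_add, LinearMap.add_apply, form_addTopL_proj hq hd, add_zero,
        form_closeTopL_proj hq hd]
  · intro hqd w D hD
    rw [hUr, projectedVector, comp_eq, closeTop_eq, ← compL_addTopL_closeTopL, ← sub_eq_zero,
      ← Pi.sub_apply, ← map_sub]
    -- Both sides are now `addTopL (P_k w)` composed on the right with combinations that agree on
    -- monic diagrams.
    refine compL_eq_zero_of_isMonic _ _ (fun D' hD' => ?_) hD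
    rw [Pi.sub_apply, closeTopL_wenzlJones hq hq' hqd hD', sub_self]
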